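/- Let $\Phi:\mathbb R\to\mathbb R$ be a $C^2$ function such that $\Phi(x+1)=\Phi(x)$ for all $x$, $\Phi'(x)\ne 0$ whenever $\Phi(x)=0$, and $\Phi''(x)\neq 0$ whenever $\Phi'(x)=0$. For $L>0$ and $a\in[0,1]$ put $S=\{x:\Phi(x)=0\}$ and $$f_a(x)=x+a+L\cdot\ln|\Phi(x)|\qquad (x\in\mathbb R\setminus S).$$ Since $f_a(x+1)=f_a(x)+1$, this induces a map of the circle $\mathbb R/\mathbb Z$ (undefined on the image of $S$); derivatives are taken on the lift. Let $C=\{x\in\mathbb R\setminus S: f_a'(x)=0\}$ be the set of critical points (it depends on $\Phi$ and $L$, but not on $a$). Let $\lambda=10^{-3}$ and let $|\cdot|$ denote Lebesgue measure on $\mathbb R$. Then there is $L_0>0$, depending only on $\Phi$, such that for every $L\ge L_0$ there is a measurable set $\Delta=\Delta(L)\subset[0,1)$ with $|\Delta(L)|>0$ and the following property: for every $a\in\Delta(L)$ and every $c\in C$, the orbit of $f_a(c)$ under $f_a$ never meets $S$ (so that all iterates $f_a^n$ are defined and differentiable at $f_a(c)$), and $$|(f_a^n)'(f_a(c))|\ge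 L^{\lambda n}\qquad\text{for every integer } n\ge 0.$$ Moreover, the sets $\Delta(L)$ can be chosen so that $|\Delta(L)|\to 1$ as $L\to\infty$. -/

import Mathlib

open Filter Topology MeasureTheory

/-- The map `f_a(x) = x + a + L ln|Φ(x)|` of the real line. It is meaningful off the singular set
`{Φ = 0}` (on which Lean's `log 0 = 0` supplies an irrelevant value). -/
noncomputable def logMap (Φ : ℝ → ℝ) (L a : ℝ) (x : ℝ) : ℝ :=
  x + a + L * Real.log |Φ x|

/-- For 1-periodic `Φ` the map commutes with the unit translation, so it is a lift of a map of
the circle `ℝ/ℤ`; derivatives of the circle map and of its iterates are those of the lift. -/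
theorem logMap_add_one {Φ : ℝ → ℝ} (hper : ∀ x, Φ (x + 1) = Φ x) (L a x : ℝ) :
    logMap Φ L a (x + 1) = logMap Φ L a x + 1 := by
  unfold logMap
  rw [hper x]
  ring

/-- The set `S` of singular points (lifted to the line): the zeros of `Φ`. -/
def singularSet (Φ : ℝ → ℝ) : Set ℝ := {x | Φ x = 0}

/-- The set `C` of critical points of `f_a` (lifted to the line). Singular points, where `f_a` has
no derivative and Lean's `deriv` is `0` by convention, are left out. -/
def criticalSet (Φ : ℝ → ℝ) (L a : ℝ) : Set ℝ :=
  {x | x ∉ singularSet Φ ∧ deriv (logMap Φ L a) x = 0}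

/-!
The proof is a parameter exclusion argument in the spirit of Jakobson and Benedicks–Carleson.

Everything is measured by the return function `V = Φ Φ' + Φ² / L`, whose zeros are the singular and
the critical points and which satisfies `f' = L V / Φ²`. Hence `|f'| ≥ const * L |V|`, and the
derivative along an orbit grows as soon as the total *depth* `∑ - log |V|` of its deep returns to
the zeros of `V` is a small proportion of `n log L`. For most parameters this holds for all critical
orbits, by the interplay of two facts.

* Only *essential* returns matter (`UniformBounds.totalDepth_le`). After a deep return near a
  critical point the orbit shadows the critical orbit for a while (`UniformBounds.shadowing`); if
  the critical orbits are good up to an earlier time, the derivative lost at the return is recovered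
  at the end of this binding period, and little depth is added during it
  (`UniformBounds.exists_recovery`). A return that takes place before the images of the
  neighbourhoods of bounded distortion have become large is paid for by the essential return
  responsible for their smallness. This bookkeeping is the invariant `FreeState`.

* Essential returns are rare in parameter space (`UniformBounds.volume_badSet_le`). Since the
  derivatives with respect to the parameter and to the phase variable are comparable, the same
  distortion estimate shows that an essential return of depth `r` at time `k` confines the parameter
  to a proportion of order `exp (- r / 2)` of its neighbourhood of bounded distortion, and Vitali's
  covering lemma turns this into a bound for measures (`UniformBounds.volume_nbhd_succ_le`). The
  bounds multiply up along the successive returns, and it remains to sum over all possible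
  itineraries of total depth at least a small multiple of `n log L`. The sum is exponentially small
  in `n log L`.
-/

namespace LogMap

/-! ### The return function and uniform local estimates -/

/-- The return function `V = Φ Φ' + Φ² / L`. It is of class `C¹`, its zeros are the singular and the
critical points of the map, all of them simple for large `L`, and `f' = L V / Φ²`. The smallness of
`|V|` therefore measures the closeness to both sets at once. -/
noncomputable def retFn (Φ : ℝ → ℝ) (L x : ℝ) : ℝ := Φ x * deriv Φ x + Φ x ^ 2 / L

/-- The derivative of the map off the singular set, written through the return function. -/
noncomputable def slope (Φ : ℝ → ℝ) (L x : ℝ) : ℝ := L * retFn Φ L x / Φ x ^ 2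

/-- The local properties of the map that the dynamical argument uses. The constants `K` and `ς`
will depend on `Φ` only, and not on `L`. Besides bounds for `Φ` and `V`, they are: the derivative
has bounded distortion on the scale `|V| / K` (`distort`); on the scale `ς` the points where `V` is
small cluster at a single zero of `V` (`sep`); and a point where `V` is small is either close to the
singular set, or close to a critical point, with quadratic behaviour of the map (`near`). -/
structure UniformBounds (Φ : ℝ → ℝ) (L K ς : ℝ) : Prop where
  L_pos : 0 < L
  one_le : 1 ≤ K
  sep_pos : 0 < ς
  differentiable : Differentiable ℝ Φ
  abs_le : ∀ x, |Φ x| ≤ K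
  ret_le : ∀ x, |retFn Φ L x| ≤ K
  distort : ∀ x z, retFn Φ L x ≠ 0 → |z - x| ≤ |retFn Φ L x| / K →
    Φ z ≠ 0 ∧ |retFn Φ L x| / 2 ≤ |retFn Φ L z| ∧
      |slope Φ L z - slope Φ L x| ≤ K / |retFn Φ L x| * |z - x| * |slope Φ L x|
  sep : ∀ t y y', |retFn Φ L y| ≤ t → |retFn Φ L y'| ≤ t → |y - y'| ≤ ς → |y - y'| ≤ K * t
  near : ∀ x, |retFn Φ L x| ≤ 1 / K → |Φ x| ≤ K * |retFn Φ L x| ∨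
    ∃ z, retFn Φ L z = 0 ∧ Φ z ≠ 0 ∧
      |logMap Φ L 0 x - logMap Φ L 0 z| ≤ K * L * |retFn Φ L x| ^ 2

lemma hasDerivAt_logMap {Φ : ℝ → ℝ} (hd : Differentiable ℝ Φ) {L : ℝ} (hL : L ≠ 0) (a : ℝ) {x : ℝ}
    (hx : Φ x ≠ 0) : HasDerivAt (logMap Φ L a) (slope Φ L x) x := by
  have h1 : HasDerivAt (fun y => Real.log |Φ y|) (deriv Φ x / Φ x) x := by
    have := ((hd x).hasDerivAt).log hx
    simpa [Real.log_abs] using this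
  have h2 := ((hasDerivAt_id x).add_const a).add (h1.const_mul L)
  have h3 : slope Φ L x = 1 + L * (deriv Φ x / Φ x) := by
    unfold slope retFn; field_simp; ring
  rw [h3]
  exact h2

lemma mem_criticalSet {Φ : ℝ → ℝ} (hd : Differentiable ℝ Φ) {L : ℝ} (hL : L ≠ 0) {a c : ℝ} :
    c ∈ criticalSet Φ L a ↔ Φ c ≠ 0 ∧ retFn Φ L c = 0 := by
  unfold criticalSet singularSet
  simp only [Set.mem_ofPred_eq]
  refine and_congr_right fun h => ?_
  rw [(hasDerivAt_logMap hd hL a h).deriv]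
  unfold slope
  simp [hL, h]

lemma exists_zero_near {V V' : ℝ → ℝ} (hV : ∀ y, HasDerivAt V (V' y) y) (hc : Continuous V')
    {x η ς : ℝ} (hη : 0 < η) (hb : ∀ y, |y - x| ≤ ς → η ≤ |V' y|) (hx : |V x| ≤ η * ς) :
    ∃ z, |x - z| ≤ |V x| / η ∧ V z = 0 := by
  wlog hpos : 0 ≤ V x generalizing V V'
  · obtain ⟨z, hz, hz'⟩ := this (V := fun y => -V y) (V' := fun y => -V' y)
      (fun y => (hV y).neg) hc.neg (by simpa using hb) (by simpa using hx) (by linarith)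
    exact ⟨z, by simpa using hz, by simpa using hz'⟩
  rcases hpos.eq_or_lt with h0 | h0
  · exact ⟨x, by simp [← h0], h0.symm⟩
  rw [abs_of_pos h0] at hx ⊢
  set ρ := V x / η with hρ
  have hρ0 : 0 < ρ := by positivity
  have hρη : η * ρ = V x := by rw [hρ]; field_simp
  have hρς : ρ ≤ ς := by rw [hρ, div_le_iff₀ hη]; linarith
  have hcont : Continuous V := continuous_iff_continuousAt.2 fun y => (hV y).continuousAt
  by_contra! hno
  have key : ∀ y, |y - x| ≤ ρ → 0 < V y := by
    intro y hy
    by_contra! hle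
    have := intermediate_value_uIcc (a := y) (b := x) hcont.continuousOn
    have h0' : (0 : ℝ) ∈ Set.uIcc (V y) (V x) := Set.mem_uIcc.2 (Or.inl ⟨hle, h0.le⟩)
    obtain ⟨z, hz, hz0⟩ := this h0'
    refine hno z ?_ hz0
    have h1 := Set.abs_sub_right_of_mem_uIcc hz
    calc |x - z| ≤ |x - y| := h1
      _ = |y - x| := abs_sub_comm _ _
      _ ≤ ρ := hy
  obtain ⟨ξ₁, h1, e1⟩ := exists_hasDerivAt_eq_slope V V' (show x < x + ρ by linarith)
    hcont.continuousOn (fun y _ => hV y)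
  obtain ⟨ξ₂, h2, e2⟩ := exists_hasDerivAt_eq_slope V V' (show x - ρ < x by linarith)
    hcont.continuousOn (fun y _ => hV y)
  rw [eq_div_iff (by linarith)] at e1 e2
  have p1 := key (x + ρ) (by simp [abs_of_pos hρ0])
  have p2 := key (x - ρ) (by simp [abs_of_pos hρ0])
  have b1 := hb ξ₁ (by rw [abs_le]; constructor <;> linarith [h1.1, h1.2])
  have b2 := hb ξ₂ (by rw [abs_le]; constructor <;> linarith [h2.1, h2.2])
  have c1 : 0 ≤ V' ξ₁ := by
    by_contra! hneg
    rw [abs_of_neg hneg] at b1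
    nlinarith
  have c2 : V' ξ₂ ≤ 0 := by
    by_contra! hneg
    rw [abs_of_pos hneg] at b2
    nlinarith
  obtain ⟨ξ, hξ, hξ0⟩ := intermediate_value_Icc (show ξ₂ ≤ ξ₁ by linarith [h1.1, h2.2])
    hc.continuousOn (⟨c2, c1⟩ : (0 : ℝ) ∈ Set.Icc (V' ξ₂) (V' ξ₁))
  have := hb ξ (by rw [abs_le]; constructor <;> linarith [h1.1, h1.2, h2.1, h2.2, hξ.1, hξ.2])
  rw [hξ0, abs_zero] at this
  linarith

lemma exists_bound_of_periodic {h : ℝ → ℝ} (hc : Continuous h) (hp : Function.Periodic h 1) :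
    ∃ M, ∀ x, |h x| ≤ M := by
  obtain ⟨M, hM⟩ := (hp.compact_of_continuous one_ne_zero hc).isBounded.exists_norm_le
  exact ⟨M, fun x => hM _ ⟨x, rfl⟩⟩

lemma exists_pos_le_of_periodic {h : ℝ → ℝ} (hc : Continuous h) (hp : Function.Periodic h 1)
    (hpos : ∀ x, 0 < h x) : ∃ m, 0 < m ∧ ∀ x, m ≤ h x := by
  obtain ⟨y, ⟨x, rfl⟩, hx⟩ := (hp.compact_of_continuous one_ne_zero hc).exists_isLeast
    (Set.range_nonempty h)
  exact ⟨h x, hpos x, fun z => hx ⟨z, rfl⟩⟩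

lemma exists_modulus_of_periodic {h : ℝ → ℝ} (hc : Continuous h) (hp : Function.Periodic h 1)
    {e : ℝ} (he : 0 < e) : ∃ s, 0 < s ∧ ∀ x y, |y - x| ≤ s → |h y - h x| ≤ e := by
  have hu := (isCompact_Icc (a := (-1 : ℝ)) (b := 2)).uniformContinuousOn_of_continuous
    hc.continuousOn
  rw [Metric.uniformContinuousOn_iff_le] at hu
  obtain ⟨δ, hδ, hu⟩ := hu e he
  refine ⟨min δ 1, by positivity, fun x y hxy => ?_⟩
  have h1 : |y - x| ≤ δ := hxy.trans (min_le_left _ _)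
  have h2 : |y - x| ≤ 1 := hxy.trans (min_le_right _ _)
  rw [abs_le] at h2
  have hf0 := Int.floor_le x
  have hf1 := Int.lt_floor_add_one x
  have e1 : h (y - ⌊x⌋) = h y := by simpa using hp.sub_zsmul_eq (n := ⌊x⌋) (x := y)
  have e2 : h (x - ⌊x⌋) = h x := by simpa using hp.sub_zsmul_eq (n := ⌊x⌋) (x := x)
  have := hu (y - ⌊x⌋) ⟨by linarith, by linarith⟩ (x - ⌊x⌋) ⟨by linarith, by linarith⟩
    (by rw [Real.dist_eq, sub_sub_sub_cancel_right]; exact h1)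
  rwa [Real.dist_eq, e1, e2] at this

lemma periodic_deriv {h : ℝ → ℝ} (hp : Function.Periodic h 1) : Function.Periodic (deriv h) 1 := by
  intro x
  have : (fun y => h (y + 1)) = h := funext hp
  rw [← deriv_comp_add_const, this]

lemma abs_sub_le_of_deriv_bound {h h' : ℝ → ℝ} {C : ℝ} (hd : ∀ x, HasDerivAt h (h' x) x)
    (hb : ∀ x, |h' x| ≤ C) (x y : ℝ) : |h y - h x| ≤ C * |y - x| :=
  Convex.norm_image_sub_le_of_norm_hasDerivWithin_le
    (fun z _ => (hd z).hasDerivWithinAt) (fun z _ => hb z) convex_univ (Set.mem_univ x)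
    (Set.mem_univ y)

/-- Since `Φ` and `Φ'` have simple zeros, `V'` is bounded away from zero near the points where `V`
is small, with all constants uniform in large `L`. -/
lemma exists_deriv_bounds (Φ : ℝ → ℝ) (hC2 : ContDiff ℝ 2 Φ) (hper : ∀ x, Φ (x + 1) = Φ x)
    (hzero : ∀ x, Φ x = 0 → deriv Φ x ≠ 0)
    (hcrit : ∀ x, deriv Φ x = 0 → deriv (deriv Φ) x ≠ 0) :
    ∃ M η ς L₁ : ℝ, 1 ≤ M ∧ 0 < η ∧ 0 < ς ∧ 1 ≤ L₁ ∧ (∀ x, |Φ x| ≤ M) ∧ (∀ x, |deriv Φ x| ≤ M) ∧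
      (∀ x, |deriv (deriv Φ) x| ≤ M) ∧
      ∀ L, L₁ ≤ L → ∀ x y, |retFn Φ L x| ≤ η → |y - x| ≤ ς →
        η ≤ |deriv Φ y ^ 2 + Φ y * deriv (deriv Φ) y + 2 * Φ y * deriv Φ y / L| := by
  have hp0 : Function.Periodic Φ 1 := hper
  have hp1 := periodic_deriv hp0
  have hp2 := periodic_deriv hp1
  have c0 : Continuous Φ := hC2.continuous
  have hC1 : ContDiff ℝ 1 (deriv Φ) := ((contDiff_succ_iff_deriv (n := 1)).1 hC2).2.2
  have c1 : Continuous (deriv Φ) := hC1.continuous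
  have c2 : Continuous (deriv (deriv Φ)) := hC1.continuous_deriv le_rfl
  obtain ⟨M0, hM0⟩ := exists_bound_of_periodic c0 hp0
  obtain ⟨M1, hM1⟩ := exists_bound_of_periodic c1 hp1
  obtain ⟨M2, hM2⟩ := exists_bound_of_periodic c2 hp2
  set M := max 1 (max M0 (max M1 M2)) with hM
  have hM1' : 1 ≤ M := le_max_left _ _
  have b0 : ∀ x, |Φ x| ≤ M := fun x => (hM0 x).trans (by simp [hM])
  have b1 : ∀ x, |deriv Φ x| ≤ M := fun x => (hM1 x).trans (by simp [hM])
  have b2 : ∀ x, |deriv (deriv Φ) x| ≤ M := fun x => (hM2 x).trans (by simp [hM])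
  set W : ℝ → ℝ := fun y => deriv Φ y ^ 2 + Φ y * deriv (deriv Φ) y with hW
  have cW : Continuous W := by fun_prop
  have pW : Function.Periodic W 1 := fun x => by simp only [hW, hp0 x, hp1 x, hp2 x]
  obtain ⟨m, hm, hmin⟩ := exists_pos_le_of_periodic (h := fun y => |Φ y * deriv Φ y| ⊔ |W y|)
    (by fun_prop) (fun x => by simp only [hp0 x, hp1 x, pW x]) (by
      intro x
      by_contra! hle
      have h1 : Φ x * deriv Φ x = 0 := abs_nonpos_iff.1 ((le_max_left _ _).trans hle)
      have h2 : W x = 0 := abs_nonpos_iff.1 ((le_max_right _ _).trans hle)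
      rcases mul_eq_zero.1 h1 with h | h
      · exact hzero x h (by simpa [hW, h] using h2)
      · have h3 : Φ x = 0 ∨ deriv (deriv Φ) x = 0 := by simpa [hW, h] using h2
        rcases h3 with h3 | h3
        · exact hzero x h3 h
        · exact hcrit x h h3)
  obtain ⟨s, hs, hmod⟩ := exists_modulus_of_periodic cW pW (show 0 < m / 4 by positivity)
  refine ⟨M, m / 2, s, max 1 (8 * M ^ 2 / m), hM1', by positivity, hs, le_max_left _ _, b0, b1, b2,
    fun L hL x y hx hxy => ?_⟩
  have hL1 : 1 ≤ L := (le_max_left _ _).trans hL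
  have hL2 : 8 * M ^ 2 / m ≤ L := (le_max_right _ _).trans hL
  have hL0 : 0 < L := by linarith
  have hML : 2 * M ^ 2 / L ≤ m / 4 := by
    rw [div_le_iff₀ hm] at hL2
    rw [div_le_iff₀ hL0]; linarith
  have q1 : |Φ x ^ 2 / L| ≤ M ^ 2 / L := by
    rw [abs_div, abs_of_pos hL0, abs_pow]
    gcongr
    exact b0 x
  have q2 : |2 * Φ y * deriv Φ y / L| ≤ 2 * M ^ 2 / L := by
    have : |Φ y| * |deriv Φ y| ≤ M * M := by gcongr; exacts [b0 y, b1 y]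
    rw [abs_div, abs_of_pos hL0, abs_mul, abs_mul, abs_two]
    exact div_le_div_of_nonneg_right (by linarith) hL0.le
  have q1' : M ^ 2 / L ≤ m / 8 := by
    have : 2 * M ^ 2 / L = 2 * (M ^ 2 / L) := by ring
    linarith
  have hxx : |Φ x * deriv Φ x| < m := by
    have : Φ x * deriv Φ x = retFn Φ L x - Φ x ^ 2 / L := by unfold retFn; ring
    rw [this]
    calc _ ≤ |retFn Φ L x| + |Φ x ^ 2 / L| := abs_sub _ _
      _ < m := by linarith
  have hWx : m ≤ |W x| := by
    rcases le_max_iff.1 (hmin x) with h | h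
    · linarith
    · exact h
  have hWy := hmod x y hxy
  have t1 : |W x| ≤ |W y - W x| + |W y| := by
    have := abs_sub_abs_le_abs_sub (W x) (W y)
    rw [abs_sub_comm] at this; linarith
  have t2 : |W y| ≤ |W y + 2 * Φ y * deriv Φ y / L| + |2 * Φ y * deriv Φ y / L| := by
    have := abs_sub (W y + 2 * Φ y * deriv Φ y / L) (2 * Φ y * deriv Φ y / L)
    simpa using this
  have : W y + 2 * Φ y * deriv Φ y / L
    = deriv Φ y ^ 2 + Φ y * deriv (deriv Φ) y + 2 * Φ y * deriv Φ y / L := rfl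
  rw [← this]
  linarith

lemma hasDerivAt_retFn {Φ : ℝ → ℝ} (hC2 : ContDiff ℝ 2 Φ) (L y : ℝ) :
    HasDerivAt (retFn Φ L)
      (deriv Φ y ^ 2 + Φ y * deriv (deriv Φ) y + 2 * Φ y * deriv Φ y / L) y := by
  have hC1 : ContDiff ℝ 1 (deriv Φ) := ((contDiff_succ_iff_deriv (n := 1)).1 hC2).2.2
  have h0 := (hC2.differentiable (by norm_num) y).hasDerivAt
  have h1 := (hC1.differentiable (by norm_num) y).hasDerivAt
  refine ((h0.mul h1).add ((h0.pow 2).div_const L)).congr_deriv ?_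
  push_cast
  ring

/-- Relative distortion of a quotient `p / q ^ 2`. -/
lemma quotient_distortion {p P q Q e : ℝ} (hp : p ≠ 0) (hq : q ≠ 0) (h1 : |P - p| ≤ 4 * e * |p|)
    (h2 : |Q - q| ≤ 2 * e * |q|) (he : 8 * e ≤ 1) :
    |P / Q ^ 2 - p / q ^ 2| ≤ 20 * e * |p / q ^ 2| := by
  set x := P / p - 1 with hx
  set y := Q / q - 1 with hy
  have hP : P = p * (1 + x) := by rw [hx]; field_simp; ring
  have hQ : Q = q * (1 + y) := by rw [hy]; field_simp; ring
  have hp' : 0 < |p| := abs_pos.2 hp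
  have hq' : 0 < |q| := abs_pos.2 hq
  have hx1 : |x| ≤ 4 * e := by
    have : P - p = x * p := by rw [hP]; ring
    rw [this, abs_mul] at h1
    exact le_of_mul_le_mul_right h1 hp'
  have hy1 : |y| ≤ 2 * e := by
    have : Q - q = y * q := by rw [hQ]; ring
    rw [this, abs_mul] at h2
    exact le_of_mul_le_mul_right h2 hq'
  have he0 : 0 ≤ e := by linarith [abs_nonneg x]
  obtain ⟨hy2, hy3⟩ := abs_le.1 hy1
  have hy4 : 3 / 4 ≤ 1 + y := by linarith
  have hpos : 0 < (1 + y) ^ 2 := by positivity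
  have key : P / Q ^ 2 - p / q ^ 2 = (x - (2 + y) * y) / (1 + y) ^ 2 * (p / q ^ 2) := by
    rw [hP, hQ]; field_simp; ring
  rw [key, abs_mul]
  refine mul_le_mul_of_nonneg_right ?_ (abs_nonneg _)
  rw [abs_div, abs_of_pos hpos, div_le_iff₀ hpos]
  have h3 : |x - (2 + y) * y| ≤ 4 * e + (9 / 4) * (2 * e) := by
    refine (abs_sub _ _).trans (add_le_add hx1 ?_)
    rw [abs_mul]
    refine mul_le_mul ?_ hy1 (abs_nonneg _) (by norm_num)
    rw [abs_le]; constructor <;> linarith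
  have h4 : 9 / 16 ≤ (1 + y) ^ 2 := by nlinarith
  nlinarith

set_option maxHeartbeats 800000 in
/-- For `C²` circle functions with simple zeros and nondegenerate critical points, the local
properties hold with the same constants for all large `L`. -/
theorem exists_uniformBounds (Φ : ℝ → ℝ) (hC2 : ContDiff ℝ 2 Φ) (hper : ∀ x, Φ (x + 1) = Φ x)
    (hzero : ∀ x, Φ x = 0 → deriv Φ x ≠ 0)
    (hcrit : ∀ x, deriv Φ x = 0 → deriv (deriv Φ) x ≠ 0) :
    ∃ K ς L₁ : ℝ, 1 ≤ L₁ ∧ ∀ L, L₁ ≤ L → UniformBounds Φ L K ς := by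
  obtain ⟨M, η, ς, L₁, hM, hη, hς, hL₁, b0, b1, b2, hV⟩ :=
    exists_deriv_bounds Φ hC2 hper hzero hcrit
  have hd : Differentiable ℝ Φ := hC2.differentiable (by norm_num)
  have hd1 : Differentiable ℝ (deriv Φ) :=
    ((contDiff_succ_iff_deriv (n := 1)).1 hC2).2.2.differentiable (by norm_num)
  have hc0 := hC2.continuous
  have hc1 : Continuous (deriv Φ) := hd1.continuous
  have hc2 : Continuous (deriv (deriv Φ)) :=
    ((contDiff_succ_iff_deriv (n := 1)).1 hC2).2.2.continuous_deriv le_rfl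
  have hM0 : 0 < M := by linarith
  -- the summands are the lower bounds for `K` required by the individual properties
  obtain ⟨K, k1, k2, k3, k4, k5, k6, k7⟩ : ∃ K : ℝ, 20 * M ^ 2 ≤ K ∧ 2 / η ≤ K ∧ ς / η ≤ K ∧
      1 / (η * ς) ≤ K ∧ M / η ≤ K ∧ 4 * M ^ 2 / η ^ 2 ≤ K ∧ 64 * M ^ 4 / η ^ 4 ≤ K := by
    have a1 : 0 < 20 * M ^ 2 := by positivity
    have a2 : 0 < 2 / η := by positivity
    have a3 : 0 < ς / η := by positivity
    have a4 : 0 < 1 / (η * ς) := by positivity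
    have a5 : 0 < M / η := by positivity
    have a6 : 0 < 4 * M ^ 2 / η ^ 2 := by positivity
    have a7 : 0 < 64 * M ^ 4 / η ^ 4 := by positivity
    exact ⟨20 * M ^ 2 + 2 / η + ς / η + 1 / (η * ς) + M / η + 4 * M ^ 2 / η ^ 2 +
      64 * M ^ 4 / η ^ 4, by linarith, by linarith, by linarith, by linarith, by linarith,
      by linarith, by linarith⟩
  have hMM : M ≤ M ^ 2 := by nlinarith
  have hK1 : 1 ≤ K := by linarith
  have hK0 : 0 < K := by linarith
  refine ⟨K, ς, L₁, hL₁, fun L hL => ?_⟩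
  have hL1 : 1 ≤ L := hL₁.trans hL
  have hL0 : 0 < L := by linarith
  set V := retFn Φ L with hVdef
  have mulb : ∀ {f g : ℝ → ℝ} (x : ℝ), |f x| ≤ M → |g x| ≤ M → |f x * g x| ≤ M ^ 2 := by
    intro f g x hf hg
    rw [abs_mul, sq]
    exact mul_le_mul hf hg (abs_nonneg _) hM0.le
  have divL : ∀ {t C : ℝ}, |t| ≤ C → |t / L| ≤ C := by
    intro t C ht
    rw [abs_div, abs_of_pos hL0]
    exact (div_le_self (abs_nonneg _) hL1).trans ht
  have bV : ∀ x, |V x| ≤ 2 * M ^ 2 := by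
    intro x
    have h1 := mulb x (b0 x) (b1 x)
    have h2 := divL (mulb x (b0 x) (b0 x))
    calc |V x| = |Φ x * deriv Φ x + Φ x * Φ x / L| := by rw [hVdef]; unfold retFn; rw [sq (Φ x)]
      _ ≤ _ := abs_add_le _ _
      _ ≤ 2 * M ^ 2 := by linarith
  have bu : ∀ x, |deriv Φ x + Φ x / L| ≤ 2 * M := fun x =>
    (abs_add_le _ _).trans (by linarith [b1 x, divL (b0 x)])
  have Vfac : ∀ x, V x = Φ x * (deriv Φ x + Φ x / L) := fun x => by
    rw [hVdef]; unfold retFn; ring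
  have hVd := hasDerivAt_retFn hC2 L
  rw [← hVdef] at hVd
  set V' : ℝ → ℝ := fun y =>
    deriv Φ y ^ 2 + Φ y * deriv (deriv Φ) y + 2 * Φ y * deriv Φ y / L with hV'
  have bV' : ∀ x, |V' x| ≤ 4 * M ^ 2 := by
    intro x
    have h1 := mulb x (b1 x) (b1 x)
    have h2 := mulb x (b0 x) (b2 x)
    have h3 := divL (mulb x (b0 x) (b1 x))
    have : V' x = deriv Φ x * deriv Φ x + Φ x * deriv (deriv Φ) x + (Φ x * deriv Φ x / L +
      Φ x * deriv Φ x / L) := by rw [hV']; ring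
    rw [this]
    refine (abs_add_three _ _ _).trans ?_
    linarith [abs_add_le (Φ x * deriv Φ x / L) (Φ x * deriv Φ x / L)]
  have lipV := abs_sub_le_of_deriv_bound hVd bV'
  have lipΦ := abs_sub_le_of_deriv_bound (fun x => (hd x).hasDerivAt) b1
  have cV' : Continuous V' := by fun_prop
  have cV : Continuous V := continuous_iff_continuousAt.2 fun y => (hVd y).continuousAt
  refine ⟨hL0, hK1, hς, hd, fun x => (b0 x).trans (by linarith), fun x => (bV x).trans (by
    linarith), ?_, ?_, ?_⟩
  · intro x z hx hz
    rw [← hVdef] at hx hz ⊢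
    have hVx : 0 < |V x| := abs_pos.2 hx
    have hΦx : Φ x ≠ 0 := fun h => hx (by rw [Vfac, h, zero_mul])
    have hz' : K * |z - x| ≤ |V x| := by
      rwa [le_div_iff₀ hK0, mul_comm] at hz
    have hz20 : 20 * M ^ 2 * |z - x| ≤ |V x| :=
      (mul_le_mul_of_nonneg_right k1 (abs_nonneg _)).trans hz'
    have hVΦ : |V x| ≤ 2 * M * |Φ x| := by
      rw [Vfac, abs_mul, mul_comm]
      exact mul_le_mul_of_nonneg_right (bu x) (abs_nonneg _)
    set e := M ^ 2 * |z - x| / |V x| with he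
    have he0 : 0 ≤ e := by positivity
    have he1 : e * |V x| = M ^ 2 * |z - x| := by rw [he]; field_simp
    have d1 : |V z - V x| ≤ 4 * e * |V x| := by
      rw [mul_assoc, he1]; linarith [lipV x z]
    have d2 : |Φ z - Φ x| ≤ 2 * e * |Φ x| := by
      have h1 : M * (M * |z - x|) ≤ M * (2 * e * |Φ x|) := by
        have : e * |V x| ≤ e * (2 * M * |Φ x|) := mul_le_mul_of_nonneg_left hVΦ he0
        nlinarith
      exact (lipΦ x z).trans (le_of_mul_le_mul_left h1 hM0)
    have he8 : 20 * e ≤ 1 := by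
      have : 20 * e * |V x| ≤ 1 * |V x| := by linarith
      exact le_of_mul_le_mul_right this hVx
    have hΦz : Φ z ≠ 0 := by
      intro h0
      rw [h0, zero_sub, abs_neg] at d2
      have : 0 < |Φ x| := abs_pos.2 hΦx
      nlinarith
    refine ⟨hΦz, ?_, ?_⟩
    · have := abs_sub_abs_le_abs_sub (V x) (V z)
      rw [abs_sub_comm] at this
      nlinarith
    · have h3 := quotient_distortion hx hΦx d1 d2 (by linarith)
      have h4 : slope Φ L z - slope Φ L x = L * (V z / Φ z ^ 2 - V x / Φ x ^ 2) := by
        unfold slope; rw [← hVdef]; ring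
      have h5 : slope Φ L x = L * (V x / Φ x ^ 2) := by
        unfold slope; rw [← hVdef]; ring
      rw [h4, h5, abs_mul, abs_mul]
      calc |L| * |V z / Φ z ^ 2 - V x / Φ x ^ 2| ≤ |L| * (20 * e * |V x / Φ x ^ 2|) := by gcongr
        _ = 20 * e * (|L| * |V x / Φ x ^ 2|) := by ring
        _ ≤ K / |V x| * |z - x| * (|L| * |V x / Φ x ^ 2|) := by
          refine mul_le_mul_of_nonneg_right ?_ (by positivity)
          rw [he]
          calc 20 * (M ^ 2 * |z - x| / |V x|) = 20 * M ^ 2 / |V x| * |z - x| := by ring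
            _ ≤ _ := by gcongr
  · intro t y y' hy hy' hyy
    rw [← hVdef] at hy hy'
    have ht0 : 0 ≤ t := (abs_nonneg _).trans hy
    by_cases ht : t ≤ η
    · wlog hlt : y < y' generalizing y y'
      · rcases (not_lt.1 hlt).eq_or_lt with h | h
        · rw [h]; simp; positivity
        · rw [abs_sub_comm] at hyy ⊢
          exact this y' y hy' hy hyy h
      obtain ⟨ξ, hξ, e⟩ := exists_hasDerivAt_eq_slope V V' hlt cV.continuousOn (fun y _ => hVd y)
      have hp : 0 < y' - y := by linarith
      rw [abs_sub_comm, abs_of_pos hp] at hyy ⊢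
      have h1 := hV L hL y ξ (by rw [← hVdef]; linarith) (by
        rw [abs_of_pos (by linarith [hξ.1])]; linarith [hξ.2])
      have h2 : η * (y' - y) ≤ 2 * t := by
        calc η * (y' - y) ≤ |V' ξ| * |y' - y| := by
              rw [abs_of_pos hp]; exact mul_le_mul_of_nonneg_right h1 hp.le
          _ = |V y' - V y| := by rw [← abs_mul, e]; congr 1; field_simp
          _ ≤ _ := (abs_sub _ _).trans (by linarith)
      have h3 : y' - y ≤ 2 * t / η := by rw [le_div_iff₀ hη]; linarith
      calc y' - y ≤ 2 * t / η := h3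
        _ = 2 / η * t := by ring
        _ ≤ K * t := by gcongr
    · push Not at ht
      calc |y - y'| ≤ ς / η * η := by rw [div_mul_cancel₀ _ hη.ne']; exact hyy
        _ ≤ K * t := by gcongr
  · intro x hx
    rw [← hVdef] at hx ⊢
    have hx' : K * |V x| ≤ 1 := by
      rwa [le_div_iff₀ hK0, mul_comm] at hx
    have hxC : ∀ {C : ℝ}, C ≤ K → C * |V x| ≤ 1 := fun h =>
      (mul_le_mul_of_nonneg_right h (abs_nonneg _)).trans hx'
    have hxη : |V x| ≤ η := by
      have := hxC k2
      rw [div_mul_eq_mul_div, div_le_one hη] at this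
      linarith [abs_nonneg (V x)]
    have hxς : |V x| ≤ η * ς := by
      have := hxC k4
      rwa [one_div, inv_mul_le_one₀ (by positivity)] at this
    have hxM : 4 * M ^ 2 * |V x| ≤ η ^ 2 := by
      have := hxC k6
      rwa [div_mul_eq_mul_div, div_le_one (by positivity)] at this
    obtain ⟨z, hz, hz0⟩ := exists_zero_near hVd cV' hη
      (fun y hy => hV L hL x y (by rw [← hVdef]; exact hxη) hy) hxς
    have hρς : |V x| / η ≤ ς := by rw [div_le_iff₀ hη]; linarith
    by_cases hΦz : Φ z = 0
    · left
      calc |Φ x| = |Φ x - Φ z| := by rw [hΦz, sub_zero]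
        _ ≤ M * |x - z| := lipΦ z x
        _ ≤ M * (|V x| / η) := by gcongr
        _ = M / η * |V x| := by ring
        _ ≤ K * |V x| := by gcongr
    · right
      refine ⟨z, hz0, hΦz, ?_⟩
      have hu : deriv Φ z + Φ z / L = 0 := by
        have := Vfac z
        rw [hz0, eq_comm, mul_eq_zero] at this
        exact this.resolve_left hΦz
      have hVz : V' z = Φ z * (deriv (deriv Φ) z + deriv Φ z / L) := by
        have : V' z = (deriv Φ z + Φ z / L) * deriv Φ z
          + Φ z * (deriv (deriv Φ) z + deriv Φ z / L) := by rw [hV']; ring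
        rw [this, hu, zero_mul, zero_add]
      have h1 : η ≤ |Φ z| * (2 * M) := by
        have h2 := hV L hL x z (by rw [← hVdef]; exact hxη) (by
          rw [abs_sub_comm]; exact hz.trans hρς)
        calc η ≤ |V' z| := h2
          _ = |Φ z| * |deriv (deriv Φ) z + deriv Φ z / L| := by rw [hVz, abs_mul]
          _ ≤ _ := by
            gcongr
            exact (abs_add_le _ _).trans (by linarith [b2 z, divL (b1 z)])
      set ρ := |V x| / η with hρ
      have hρ0 : 0 ≤ ρ := by positivity
      have hρη : ρ * η = |V x| := by rw [hρ]; field_simp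
      have hρM : 4 * M ^ 2 * ρ ≤ η := by
        have : 4 * M ^ 2 * ρ * η ≤ η * η := by rw [mul_assoc, hρη]; linarith
        exact le_of_mul_le_mul_right this hη
      have hseg : ∀ y ∈ Metric.closedBall z ρ, η ≤ 4 * M * |Φ y| := by
        intro y hy
        rw [Metric.mem_closedBall, Real.dist_eq] at hy
        have h3 := lipΦ y z
        rw [abs_sub_comm z y] at h3
        have h4 : M * |y - z| ≤ M * ρ := by gcongr
        have h5 := abs_sub_abs_le_abs_sub (Φ z) (Φ y)
        have h6 : |Φ z| ≤ |Φ y| + M * ρ := by linarith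
        have h7 : |Φ z| * (2 * M) ≤ (|Φ y| + M * ρ) * (2 * M) := by gcongr
        have h8 : (|Φ y| + M * ρ) * (2 * M) = 4 * M * |Φ y| / 2 + 4 * M ^ 2 * ρ / 2 := by ring
        linarith
      have hds : ∀ y ∈ Metric.closedBall z ρ,
          |slope Φ L y| ≤ 64 * M ^ 4 / η ^ 2 * L * ρ := by
        intro y hy
        have h3 := hseg y hy
        rw [Metric.mem_closedBall, Real.dist_eq] at hy
        have h4 := lipV z y
        rw [hz0, sub_zero] at h4
        have hΦy : 0 < |Φ y| := by
          by_contra! hle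
          have : |Φ y| = 0 := le_antisymm hle (abs_nonneg _)
          rw [this, mul_zero] at h3
          linarith
        have h5 : η ^ 2 ≤ 16 * M ^ 2 * |Φ y| ^ 2 := by
          calc η ^ 2 ≤ (4 * M * |Φ y|) ^ 2 := by gcongr
            _ = _ := by ring
        unfold slope
        rw [← hVdef, abs_div, abs_mul, abs_of_pos hL0, abs_pow, div_le_iff₀ (by positivity)]
        calc L * |V y| ≤ L * (4 * M ^ 2 * ρ) := by
              gcongr
              exact h4.trans (by gcongr)
          _ = 4 * M ^ 2 * L * ρ * (η ^ 2 / η ^ 2) := by rw [div_self (by positivity)]; ring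
          _ ≤ 4 * M ^ 2 * L * ρ * (16 * M ^ 2 * |Φ y| ^ 2 / η ^ 2) := by gcongr
          _ = _ := by ring
      have hmvt : |logMap Φ L 0 x - logMap Φ L 0 z| ≤
          64 * M ^ 4 / η ^ 2 * L * ρ * |x - z| := by
        refine Convex.norm_image_sub_le_of_norm_hasDerivWithin_le (f := logMap Φ L 0)
          (f' := slope Φ L) (s := Metric.closedBall z ρ) (fun y hy => ?_) hds
          (convex_closedBall z ρ) (Metric.mem_closedBall_self hρ0)
          (by rw [Metric.mem_closedBall, Real.dist_eq]; exact hz)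
        refine (hasDerivAt_logMap hd hL0.ne' 0 fun h => ?_).hasDerivWithinAt
        have := hseg y hy
        rw [h, abs_zero, mul_zero] at this
        linarith
      calc |logMap Φ L 0 x - logMap Φ L 0 z| ≤ 64 * M ^ 4 / η ^ 2 * L * ρ * |x - z| := hmvt
        _ ≤ 64 * M ^ 4 / η ^ 2 * L * ρ * ρ := by gcongr
        _ = 64 * M ^ 4 / η ^ 4 * L * |V x| ^ 2 := by rw [hρ]; field_simp
        _ ≤ K * L * |V x| ^ 2 := by gcongr

/-! ### Orbits and bounded distortion -/

/-- The orbit of `x` under the map with parameter `a`. -/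
noncomputable def orb (Φ : ℝ → ℝ) (L a x : ℝ) (k : ℕ) : ℝ := (logMap Φ L a)^[k] x

/-- The derivative of the `n`-th iterate along the orbit of `x`, as a product. -/
noncomputable def der (Φ : ℝ → ℝ) (L a x : ℝ) (n : ℕ) : ℝ :=
  ∏ k ∈ Finset.range n, slope Φ L (orb Φ L a x k)

lemma orb_zero (Φ : ℝ → ℝ) (L a x : ℝ) : orb Φ L a x 0 = x := rfl

lemma orb_succ (Φ : ℝ → ℝ) (L a x : ℝ) (k : ℕ) :
    orb Φ L a x (k + 1) = logMap Φ L a (orb Φ L a x k) := Function.iterate_succ_apply' _ _ _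

lemma orb_add (Φ : ℝ → ℝ) (L a x : ℝ) (m k : ℕ) :
    orb Φ L a x (m + k) = orb Φ L a (orb Φ L a x m) k := by
  unfold orb
  rw [add_comm, Function.iterate_add_apply]

lemma der_zero (Φ : ℝ → ℝ) (L a x : ℝ) : der Φ L a x 0 = 1 := rfl

lemma der_succ (Φ : ℝ → ℝ) (L a x : ℝ) (n : ℕ) :
    der Φ L a x (n + 1) = slope Φ L (orb Φ L a x n) * der Φ L a x n := by
  unfold der; rw [Finset.prod_range_succ, mul_comm]

lemma der_add (Φ : ℝ → ℝ) (L a x : ℝ) (m k : ℕ) :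
    der Φ L a x (m + k) = der Φ L a x m * der Φ L a (orb Φ L a x m) k := by
  unfold der
  rw [Finset.prod_range_add]
  simp_rw [orb_add]

lemma logMap_eq (Φ : ℝ → ℝ) (L a x : ℝ) : logMap Φ L a x = logMap Φ L 0 x + a := by
  unfold logMap; ring

lemma slope_ne_zero {Φ : ℝ → ℝ} {L x : ℝ} (hL : 0 < L) (h : retFn Φ L x ≠ 0) :
    slope Φ L x ≠ 0 := by
  have : Φ x ≠ 0 := fun h0 => h (by unfold retFn; simp [h0])
  unfold slope
  positivity

lemma der_ne_zero {Φ : ℝ → ℝ} {L a x : ℝ} (hL : 0 < L) {n : ℕ}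
    (h : ∀ k < n, retFn Φ L (orb Φ L a x k) ≠ 0) : der Φ L a x n ≠ 0 :=
  Finset.prod_ne_zero_iff.2 fun k hk => slope_ne_zero hL (h k (Finset.mem_range.1 hk))

/-- Near a point with `V ≠ 0` the increments of the map are almost linear. -/
lemma UniformBounds.increment {Φ : ℝ → ℝ} {L K ς : ℝ} (ub : UniformBounds Φ L K ς) {x y y' ρ : ℝ}
    (hx : retFn Φ L x ≠ 0) (hρ : ρ ≤ |retFn Φ L x| / K) (hy : |y - x| ≤ ρ) (hy' : |y' - x| ≤ ρ) :
    |logMap Φ L 0 y - logMap Φ L 0 y' - slope Φ L x * (y - y')| ≤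
      K / |retFn Φ L x| * ρ * |slope Φ L x| * |y - y'| := by
  have hK := ub.one_le
  have hder : ∀ z ∈ Metric.closedBall x ρ,
      HasDerivWithinAt (fun z => logMap Φ L 0 z - slope Φ L x * z)
        (slope Φ L z - slope Φ L x) (Metric.closedBall x ρ) z := by
    intro z hz
    rw [Metric.mem_closedBall, Real.dist_eq] at hz
    have h1 := hasDerivAt_logMap ub.differentiable ub.L_pos.ne' 0
      (ub.distort x z hx (hz.trans hρ)).1
    exact (h1.sub (by simpa using (hasDerivAt_id z).const_mul (slope Φ L x))).hasDerivWithinAt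
  have hb : ∀ z ∈ Metric.closedBall x ρ,
      ‖slope Φ L z - slope Φ L x‖ ≤ K / |retFn Φ L x| * ρ * |slope Φ L x| := by
    intro z hz
    rw [Metric.mem_closedBall, Real.dist_eq] at hz
    refine (ub.distort x z hx (hz.trans hρ)).2.2.trans ?_
    gcongr
  have := Convex.norm_image_sub_le_of_norm_hasDerivWithin_le hder hb (convex_closedBall x ρ)
    (x := y') (y := y) (by rwa [Metric.mem_closedBall, Real.dist_eq])
    (by rwa [Metric.mem_closedBall, Real.dist_eq])
  rw [Real.norm_eq_abs, Real.norm_eq_abs] at this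
  convert this using 2
  ring

/-- Shadowing with bounded distortion, in phase space (`κ = 0`) and in parameter space (`κ = 1`)
alike: as long as the perturbation `D` is small against the distortion sum of the reference orbit,
increments are multiplied by the derivative along the reference orbit up to a factor in
`[1/2, 3/2]`, and so are the derivatives themselves. -/
theorem UniformBounds.shadowing {Φ : ℝ → ℝ} {L K ς : ℝ} (ub : UniformBounds Φ L K ς)
    {a x κ D : ℝ} (hκ0 : 0 ≤ κ) (hD0 : 0 ≤ D) {n : ℕ}
    (hV : ∀ k < n, retFn Φ L (orb Φ L a x k) ≠ 0)
    (hD : D * ∑ k ∈ Finset.range n, |der Φ L a x k| * (K / |retFn Φ L (orb Φ L a x k)|) ≤ 1 / 32)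
    (hκ : κ * ∑ k ∈ Finset.range n, 1 / |der Φ L a x (k + 1)| ≤ 1 / 8) {k : ℕ} (hk : k ≤ n) :
    (∀ s s', |s| ≤ D → |s'| ≤ D →
      |orb Φ L (a + κ * s) (x + s) k - orb Φ L (a + κ * s') (x + s') k - der Φ L a x k * (s - s')|
        ≤ 1 / 2 * |der Φ L a x k| * |s - s'|) ∧
    ∀ s, |s| ≤ D →
      |der Φ L (a + κ * s) (x + s) k - der Φ L a x k| ≤ 1 / 2 * |der Φ L a x k| := by
  have hK := ub.one_le
  have hL := ub.L_pos
  set X : ℝ → ℕ → ℝ := fun s k => orb Φ L (a + κ * s) (x + s) k with hX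
  set T : ℕ → ℝ := fun k => der Φ L a x k with hT
  set w : ℕ → ℝ := fun k => K / |retFn Φ L (orb Φ L a x k)| with hw
  set e : ℕ → ℝ := fun k => 4 * (D * ∑ j ∈ Finset.range k, |T j| * w j) +
    κ * ∑ j ∈ Finset.range k, 1 / |T (j + 1)| with he
  have hw0 : ∀ k, 0 ≤ w k := fun k => by positivity
  have he_succ : ∀ k, e (k + 1) = e k + 4 * (D * (|T k| * w k)) + κ * (1 / |T (k + 1)|) := by
    intro k; simp only [he, Finset.sum_range_succ]; ring
  have hsum : ∀ k ≤ n, D * ∑ j ∈ Finset.range k, |T j| * w j ≤ 1 / 32 := fun k hk =>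
    le_trans (mul_le_mul_of_nonneg_left (Finset.sum_le_sum_of_subset_of_nonneg
      (Finset.range_mono hk) fun j _ _ => mul_nonneg (abs_nonneg _) (hw0 j)) hD0) hD
  have hsum' : ∀ k ≤ n, κ * ∑ j ∈ Finset.range k, 1 / |T (j + 1)| ≤ 1 / 8 := fun k hk =>
    le_trans (mul_le_mul_of_nonneg_left (Finset.sum_le_sum_of_subset_of_nonneg
      (Finset.range_mono hk) fun j _ _ => by positivity) hκ0) hκ
  have he_le : ∀ k ≤ n, e k ≤ 1 / 2 := fun k hk => by
    have := hsum k hk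
    have := hsum' k hk
    simp only [he]; linarith
  have hterm : ∀ k < n, D * (|T k| * w k) ≤ 1 / 32 := fun k hk => by
    refine le_trans ?_ (hsum (k + 1) hk)
    refine mul_le_mul_of_nonneg_left ?_ hD0
    exact Finset.single_le_sum (f := fun j => |T j| * w j)
      (fun j _ => mul_nonneg (abs_nonneg _) (hw0 j)) (Finset.self_mem_range_succ k)
  have main : ∀ k ≤ n, (∀ s s', |s| ≤ D → |s'| ≤ D →
      |X s k - X s' k - T k * (s - s')| ≤ e k * |T k| * |s - s'|) ∧
      ∀ s, |s| ≤ D → |der Φ L (a + κ * s) (x + s) k - T k| ≤ e k * |T k| := by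
    intro k
    induction k with
    | zero =>
      intro _
      refine ⟨fun s s' _ _ => ?_, fun s _ => ?_⟩
      · simp [hX, hT, he, orb_zero, der_zero]
      · simp [hT, he, der_zero]
    | succ k ih =>
      intro hk
      obtain ⟨ih1, ih2⟩ := ih (by omega)
      have hkn : k < n := by omega
      have hVk := hV k hkn
      have hVk' : 0 < |retFn Φ L (orb Φ L a x k)| := abs_pos.2 hVk
      have hTk1 : 0 < |T (k + 1)| := abs_pos.2 (der_ne_zero hL fun j hj => hV j (by omega))
      have hTs : T (k + 1) = slope Φ L (orb Φ L a x k) * T k := der_succ _ _ _ _ _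
      have hX0 : X 0 k = orb Φ L a x k := by simp [hX]
      have hek := he_le k hkn.le
      have hδ : ∀ s s', |s| ≤ D → |s'| ≤ D → |X s k - X s' k| ≤ 2 * |T k| * |s - s'| := by
        intro s s' hs hs'
        have h1 := ih1 s s' hs hs'
        have h2 : |X s k - X s' k| ≤ |X s k - X s' k - T k * (s - s')| + |T k * (s - s')| := by
          simpa using abs_add_le (X s k - X s' k - T k * (s - s')) (T k * (s - s'))
        rw [abs_mul] at h2
        have h3 : e k * |T k| * |s - s'| ≤ 1 * |T k| * |s - s'| := by gcongr; linarith
        linarith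
      have hnear : ∀ s, |s| ≤ D → |X s k - orb Φ L a x k| ≤ 2 * |T k| * D := by
        intro s hs
        rw [← hX0]
        refine (hδ s 0 hs (by simpa using hD0)).trans ?_
        rw [sub_zero]; gcongr
      have hρ : 2 * |T k| * D ≤ |retFn Φ L (orb Φ L a x k)| / K := by
        have h1 := hterm k hkn
        have h2 : D * (|T k| * w k) = |T k| * D / (|retFn Φ L (orb Φ L a x k)| / K) := by
          simp only [hw]; field_simp
        rw [h2, div_le_iff₀ (by positivity)] at h1
        have : 0 < |retFn Φ L (orb Φ L a x k)| / K := by positivity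
        linarith
      refine ⟨fun s s' hs hs' => ?_, fun s hs => ?_⟩
      · have hinc := ub.increment hVk hρ (hnear s hs) (hnear s' hs')
        have hX1 : X s (k + 1) - X s' (k + 1)
            = logMap Φ L 0 (X s k) - logMap Φ L 0 (X s' k) + κ * (s - s') := by
          simp only [hX, orb_succ]
          rw [logMap_eq Φ L (a + κ * s), logMap_eq Φ L (a + κ * s')]; ring
        have hsplit : X s (k + 1) - X s' (k + 1) - T (k + 1) * (s - s') =
            (logMap Φ L 0 (X s k) - logMap Φ L 0 (X s' k)
              - slope Φ L (orb Φ L a x k) * (X s k - X s' k)) +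
            slope Φ L (orb Φ L a x k) * (X s k - X s' k - T k * (s - s')) + κ * (s - s') := by
          rw [hX1, hTs]; ring
        rw [hsplit]
        refine (abs_add_three _ _ _).trans ?_
        rw [abs_mul, abs_mul κ, abs_of_nonneg hκ0]
        have b1 : K / |retFn Φ L (orb Φ L a x k)| * (2 * |T k| * D) *
            |slope Φ L (orb Φ L a x k)| * |X s k - X s' k| ≤
            4 * (D * (|T k| * w k)) * |T (k + 1)| * |s - s'| := by
          calc _ ≤ w k * (2 * |T k| * D) * |slope Φ L (orb Φ L a x k)| *
                (2 * |T k| * |s - s'|) := by gcongr; exact hδ s s' hs hs'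
            _ = _ := by rw [hTs, abs_mul]; ring
        have b2 : |slope Φ L (orb Φ L a x k)| * |X s k - X s' k - T k * (s - s')| ≤
            e k * |T (k + 1)| * |s - s'| := by
          calc _ ≤ |slope Φ L (orb Φ L a x k)| * (e k * |T k| * |s - s'|) := by
                gcongr; exact ih1 s s' hs hs'
            _ = _ := by rw [hTs, abs_mul]; ring
        have b3 : κ * |s - s'| = κ * (1 / |T (k + 1)|) * |T (k + 1)| * |s - s'| := by
          field_simp
        rw [he_succ, b3]
        linarith
      · have hd := (ub.distort _ _ hVk ((hnear s hs).trans hρ)).2.2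
        have hsplit : der Φ L (a + κ * s) (x + s) (k + 1) - T (k + 1) =
            (slope Φ L (X s k) - slope Φ L (orb Φ L a x k)) * der Φ L (a + κ * s) (x + s) k +
            slope Φ L (orb Φ L a x k) * (der Φ L (a + κ * s) (x + s) k - T k) := by
          rw [hTs, der_succ]; ring
        have hder : |der Φ L (a + κ * s) (x + s) k| ≤ 2 * |T k| := by
          have h1 := ih2 s hs
          have h2 := abs_sub_abs_le_abs_sub (der Φ L (a + κ * s) (x + s) k) (T k)
          have h3 : e k * |T k| ≤ 1 * |T k| := by gcongr; linarith
          linarith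
        rw [hsplit]
        refine (abs_add_le _ _).trans ?_
        rw [abs_mul, abs_mul]
        have b1 : |slope Φ L (X s k) - slope Φ L (orb Φ L a x k)| *
            |der Φ L (a + κ * s) (x + s) k| ≤ 4 * (D * (|T k| * w k)) * |T (k + 1)| := by
          calc _ ≤ (w k * (2 * |T k| * D) * |slope Φ L (orb Φ L a x k)|) * (2 * |T k|) := by
                gcongr
                refine hd.trans ?_
                gcongr
                exact hnear s hs
            _ = _ := by rw [hTs, abs_mul]; ring
        have b2 : |slope Φ L (orb Φ L a x k)| * |der Φ L (a + κ * s) (x + s) k - T k| ≤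
            e k * |T (k + 1)| := by
          calc _ ≤ |slope Φ L (orb Φ L a x k)| * (e k * |T k|) := by
                gcongr; exact ih2 s hs
            _ = _ := by rw [hTs, abs_mul]; ring
        have b3 : 0 ≤ κ * (1 / |T (k + 1)|) * |T (k + 1)| := by positivity
        rw [he_succ]
        linarith
  obtain ⟨m1, m2⟩ := main k hk
  have hek := he_le k hk
  refine ⟨fun s s' hs hs' => (m1 s s' hs hs').trans ?_, fun s hs => (m2 s hs).trans ?_⟩
  · gcongr
  · gcongr

/-! ### Depths of returns and growth of derivatives -/

/-- The depth `- log |V|` of the orbit at time `k`, truncated at `(k + 1) log L`, so that it is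
finite, and still large, when the orbit hits a zero of `V`. -/
noncomputable def depth (Φ : ℝ → ℝ) (L a x : ℝ) (k : ℕ) : ℝ :=
  -Real.log (max |retFn Φ L (orb Φ L a x k)| (Real.exp (-(Real.log L * (k + 1)))))

/-- The distortion sum of the first `n` iterates. Its inverse is, up to a constant, the radius of a
neighbourhood on which the `n`-th iterate has bounded distortion. -/
noncomputable def distSum (Φ : ℝ → ℝ) (L K a x : ℝ) (n : ℕ) : ℝ :=
  ∑ k ∈ Finset.range n, |der Φ L a x k| * (K * Real.exp (depth Φ L a x k))

open Classical in
/-- The depth at time `k` if the return is deep, that is `|V| ≤ L ^ (-1/1000)`, and zero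
otherwise. -/
noncomputable def deepDepth (Φ : ℝ → ℝ) (L a x : ℝ) (k : ℕ) : ℝ :=
  if Real.log L / 1000 ≤ depth Φ L a x k then depth Φ L a x k else 0

open Classical in
/-- The depth at time `k` if the return is deep and essential, and zero otherwise. A return is
essential if the neighbourhood of bounded distortion grows, up to time `k`, to a length that is
much larger than the distance to the zeros of `V`. -/
noncomputable def essDepth (Φ : ℝ → ℝ) (L K a x : ℝ) (k : ℕ) : ℝ :=
  if Real.log L / 1000 ≤ depth Φ L a x k ∧ distSum Φ L K a x k + |der Φ L a x k| ≤
    Real.exp (depth Φ L a x k / 4) * |der Φ L a x k| then depth Φ L a x k else 0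

/-- Total depth of the deep returns before time `n`. -/
noncomputable def totalDepth (Φ : ℝ → ℝ) (L a x : ℝ) (n : ℕ) : ℝ :=
  ∑ k ∈ Finset.range n, deepDepth Φ L a x k

/-- Total depth of the essential deep returns before time `n`. -/
noncomputable def totalEss (Φ : ℝ → ℝ) (L K a x : ℝ) (n : ℕ) : ℝ :=
  ∑ k ∈ Finset.range n, essDepth Φ L K a x k

variable {Φ : ℝ → ℝ} {L K ς a x : ℝ}

lemma exp_neg_depth (Φ : ℝ → ℝ) (L a x : ℝ) (k : ℕ) : Real.exp (-depth Φ L a x k) =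
    max |retFn Φ L (orb Φ L a x k)| (Real.exp (-(Real.log L * (k + 1)))) := by
  unfold depth
  rw [neg_neg, Real.exp_log (lt_max_of_lt_right (Real.exp_pos _))]

lemma abs_ret_le (Φ : ℝ → ℝ) (L a x : ℝ) (k : ℕ) :
    |retFn Φ L (orb Φ L a x k)| ≤ Real.exp (-depth Φ L a x k) := by
  rw [exp_neg_depth]; exact le_max_left _ _

lemma depth_le (Φ : ℝ → ℝ) (L a x : ℝ) (k : ℕ) : depth Φ L a x k ≤ Real.log L * (k + 1) := by
  have h : Real.exp (-(Real.log L * (k + 1))) ≤ Real.exp (-depth Φ L a x k) := by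
    rw [exp_neg_depth]; exact le_max_right _ _
  have := Real.exp_le_exp.1 h
  linarith

lemma abs_ret_eq {k : ℕ} (h : depth Φ L a x k < Real.log L * (k + 1)) :
    |retFn Φ L (orb Φ L a x k)| = Real.exp (-depth Φ L a x k) := by
  have h1 : Real.exp (-(Real.log L * (k + 1))) < Real.exp (-depth Φ L a x k) :=
    Real.exp_lt_exp.2 (by linarith)
  rw [exp_neg_depth, lt_max_iff] at h1
  rw [exp_neg_depth, max_eq_left]
  rcases h1 with h1 | h1
  · exact h1.le
  · exact absurd h1 (lt_irrefl _)

/-- `L` is large in terms of `K`. -/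
def IsLarge (L K : ℝ) : Prop := 10 ^ 6 * (Real.log K + 10) ≤ Real.log L

lemma UniformBounds.log_nonneg (ub : UniformBounds Φ L K ς) : 0 ≤ Real.log K :=
  Real.log_nonneg ub.one_le

lemma UniformBounds.exp_log_K (ub : UniformBounds Φ L K ς) : Real.exp (Real.log K) = K :=
  Real.exp_log (by linarith [ub.one_le])

lemma UniformBounds.neg_log_le_depth (ub : UniformBounds Φ L K ς) (hl : IsLarge L K) (k : ℕ) :
    -Real.log K ≤ depth Φ L a x k := by
  have hκ := ub.log_nonneg
  have hl' : 0 ≤ Real.log L := by unfold IsLarge at hl; linarith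
  have h : Real.exp (-depth Φ L a x k) ≤ Real.exp (Real.log K) := by
    rw [exp_neg_depth, ub.exp_log_K]
    refine max_le (ub.ret_le _) (le_trans ?_ ub.one_le)
    rw [Real.exp_le_one_iff]
    have : (0 : ℝ) ≤ Real.log L * (k + 1) := by positivity
    linarith
  have := Real.exp_le_exp.1 h
  linarith

lemma UniformBounds.one_le_weight (ub : UniformBounds Φ L K ς) (hl : IsLarge L K) (k : ℕ) :
    1 ≤ K * Real.exp (depth Φ L a x k) := by
  have := ub.neg_log_le_depth hl (a := a) (x := x) k
  calc (1 : ℝ) ≤ Real.exp (Real.log K + depth Φ L a x k) := by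
        rw [Real.one_le_exp_iff]; linarith
    _ = _ := by rw [Real.exp_add, ub.exp_log_K]

lemma deepDepth_nonneg (hl : 0 ≤ Real.log L) (a x : ℝ) (k : ℕ) : 0 ≤ deepDepth Φ L a x k := by
  unfold deepDepth; split_ifs with h <;> linarith

lemma depth_le_deepDepth_add (hl : 0 ≤ Real.log L) (a x : ℝ) (k : ℕ) :
    depth Φ L a x k ≤ deepDepth Φ L a x k + Real.log L / 1000 := by
  unfold deepDepth; split_ifs with h <;> linarith

lemma essDepth_nonneg (hl : 0 ≤ Real.log L) (a x : ℝ) (k : ℕ) : 0 ≤ essDepth Φ L K a x k := by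
  unfold essDepth; split_ifs with h
  · linarith [h.1]
  · exact le_rfl

lemma totalDepth_succ (Φ : ℝ → ℝ) (L a x : ℝ) (n : ℕ) :
    totalDepth Φ L a x (n + 1) = totalDepth Φ L a x n + deepDepth Φ L a x n :=
  Finset.sum_range_succ _ _

lemma totalEss_succ (Φ : ℝ → ℝ) (L K a x : ℝ) (n : ℕ) :
    totalEss Φ L K a x (n + 1) = totalEss Φ L K a x n + essDepth Φ L K a x n :=
  Finset.sum_range_succ _ _

lemma distSum_succ (Φ : ℝ → ℝ) (L K a x : ℝ) (n : ℕ) : distSum Φ L K a x (n + 1) =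
    distSum Φ L K a x n + |der Φ L a x n| * (K * Real.exp (depth Φ L a x n)) :=
  Finset.sum_range_succ _ _

lemma totalDepth_nonneg (hl : 0 ≤ Real.log L) (a x : ℝ) (n : ℕ) : 0 ≤ totalDepth Φ L a x n :=
  Finset.sum_nonneg fun k _ => deepDepth_nonneg hl a x k

lemma totalDepth_mono (hl : 0 ≤ Real.log L) (a x : ℝ) : Monotone (totalDepth Φ L a x) :=
  monotone_nat_of_le_succ fun n => by
    rw [totalDepth_succ]; linarith [deepDepth_nonneg (Φ := Φ) hl a x n]

lemma totalEss_nonneg (hl : 0 ≤ Real.log L) (a x : ℝ) (n : ℕ) : 0 ≤ totalEss Φ L K a x n :=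
  Finset.sum_nonneg fun k _ => essDepth_nonneg hl a x k

lemma totalEss_mono (hl : 0 ≤ Real.log L) (a x : ℝ) : Monotone (totalEss Φ L K a x) :=
  monotone_nat_of_le_succ fun n => by
    rw [totalEss_succ]; linarith [essDepth_nonneg (Φ := Φ) (K := K) hl a x n]

lemma UniformBounds.distSum_nonneg (ub : UniformBounds Φ L K ς) (a x : ℝ) (n : ℕ) :
    0 ≤ distSum Φ L K a x n :=
  Finset.sum_nonneg fun k _ => by have := ub.one_le; positivity

lemma deepDepth_le_totalDepth (hl : 0 ≤ Real.log L) (a x : ℝ) (k : ℕ) :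
    deepDepth Φ L a x k ≤ totalDepth Φ L a x (k + 1) := by
  rw [totalDepth_succ]; linarith [totalDepth_nonneg (Φ := Φ) hl a x k]

lemma abs_ret_eq_of_totalDepth (hl : 0 < Real.log L) {k : ℕ}
    (h : totalDepth Φ L a x (k + 1) ≤ 3 / 10 ^ 5 * (Real.log L * (k + 1 : ℕ))) :
    |retFn Φ L (orb Φ L a x k)| = Real.exp (-depth Φ L a x k) := by
  refine abs_ret_eq ?_
  have h1 := depth_le_deepDepth_add (Φ := Φ) hl.le a x k
  have h2 := deepDepth_le_totalDepth (Φ := Φ) hl.le a x k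
  push_cast at h
  have h3 : Real.log L ≤ Real.log L * (k + 1) := by
    have : (0 : ℝ) ≤ k := by positivity
    nlinarith
  linarith

lemma UniformBounds.le_slope (ub : UniformBounds Φ L K ς) {y d : ℝ}
    (h : |retFn Φ L y| = Real.exp (-d)) :
    Real.exp (Real.log L - d - 2 * Real.log K) ≤ |slope Φ L y| := by
  have hL := ub.L_pos
  have hK := ub.one_le
  have hΦ : Φ y ≠ 0 := fun h0 => by
    have : retFn Φ L y = 0 := by unfold retFn; simp [h0]
    rw [this, abs_zero] at h
    exact (Real.exp_pos _).ne h
  have h1 : Real.exp (Real.log L - d - 2 * Real.log K) = L * Real.exp (-d) / K ^ 2 := by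
    rw [show Real.log L - d - 2 * Real.log K = Real.log L + -d - (Real.log K + Real.log K) by ring,
      Real.exp_sub, Real.exp_add, Real.exp_add, Real.exp_log hL, ub.exp_log_K, sq]
  unfold slope
  rw [h1, abs_div, abs_mul, abs_of_pos hL, h, abs_pow]
  gcongr
  exact ub.abs_le y

/-- The derivative grows by a factor `L ^ (99/100)` per iterate, up to the losses at the deep
returns. -/
lemma UniformBounds.growth (ub : UniformBounds Φ L K ς) (hl : IsLarge L K) {j n : ℕ} (hjn : j ≤ n)
    (hV : ∀ k < n, |retFn Φ L (orb Φ L a x k)| = Real.exp (-depth Φ L a x k)) :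
    |der Φ L a x j| * Real.exp (99 / 100 * Real.log L * ((n : ℝ) - j) -
      (totalDepth Φ L a x n - totalDepth Φ L a x j)) ≤ |der Φ L a x n| := by
  have hκ := ub.log_nonneg
  unfold IsLarge at hl
  induction n, hjn using Nat.le_induction with
  | base => simp
  | succ n hjn ih =>
    have ih := ih fun k hk => hV k (by omega)
    have h1 := ub.le_slope (hV n (by omega))
    have h2 := depth_le_deepDepth_add (Φ := Φ) (L := L) (by linarith) a x n
    rw [der_succ, abs_mul, totalDepth_succ, mul_comm |slope _ _ _|]
    push_cast
    calc _ ≤ |der Φ L a x j| * Real.exp ((99 / 100 * Real.log L * ((n : ℝ) - j) -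
          (totalDepth Φ L a x n - totalDepth Φ L a x j)) +
          (Real.log L - depth Φ L a x n - 2 * Real.log K)) := by
          gcongr
          linarith
      _ = |der Φ L a x j| * Real.exp (99 / 100 * Real.log L * ((n : ℝ) - j) -
          (totalDepth Φ L a x n - totalDepth Φ L a x j)) *
          Real.exp (Real.log L - depth Φ L a x n - 2 * Real.log K) := by
          rw [Real.exp_add, ← mul_assoc]
      _ ≤ _ := by gcongr

/-- If the total depth is a small proportion of the time, the derivatives grow exponentially. -/
lemma UniformBounds.der_growth (ub : UniformBounds Φ L K ς) (hl : IsLarge L K) {n : ℕ}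
    (hR : ∀ j ≤ n, totalDepth Φ L a x j ≤ 3 / 10 ^ 5 * (Real.log L * j)) :
    Real.exp (9 / 10 * Real.log L * n) ≤ |der Φ L a x n| := by
  have hκ := ub.log_nonneg
  have hl0 : 0 < Real.log L := by unfold IsLarge at hl; linarith
  have h := ub.growth hl (a := a) (x := x) (Nat.zero_le n)
    fun k hk => abs_ret_eq_of_totalDepth hl0 (hR (k + 1) hk)
  refine le_trans ?_ h
  have h1 := hR n le_rfl
  have h2 : (0 : ℝ) ≤ Real.log L * n := by positivity
  rw [der_zero, abs_one, one_mul]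
  refine Real.exp_le_exp.2 ?_
  have : totalDepth Φ L a x 0 = 0 := by simp [totalDepth]
  rw [this]
  push_cast
  linarith

/-! ### Recovery after deep returns -/

/-- Recovery at time `m + 1 + p` from a deep return at time `m`: the derivative has grown by a
factor close to the exponential of the depth, the distortion caused in between is under control, and
the total depth of the returns in between is small against the depth at time `m`. -/
structure Recovery (Φ : ℝ → ℝ) (L K a x : ℝ) (m p : ℕ) : Prop where
  ret_ne : ∀ k ≤ p, retFn Φ L (orb Φ L a x (m + k)) ≠ 0
  der_ge : Real.exp (9 / 10 * depth Φ L a x m) ≤ |der Φ L a (orb Φ L a x m) (1 + p)|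
  dist_le : distSum Φ L K a x (m + 1 + p) ≤ distSum Φ L K a x m + |der Φ L a x m| *
    (|der Φ L a (orb Φ L a x m) (1 + p)| * (Real.exp (1 / 10 * depth Φ L a x m) - 1))
  depth_le : ∀ j ≤ p, totalDepth Φ L a x (m + 1 + j) ≤
    totalDepth Φ L a x m + 11 / 10 * depth Φ L a x m

lemma two_le_exp_one : (2 : ℝ) ≤ Real.exp 1 := by
  have := Real.add_one_le_exp (1 : ℝ); linarith

lemma deepDepth_of_le {k : ℕ} (h : Real.log L / 1000 ≤ depth Φ L a x k) :
    deepDepth Φ L a x k = depth Φ L a x k := by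
  unfold deepDepth; rw [if_pos h]

/-- A deep return with large derivative recovers at once. -/
lemma UniformBounds.recovery_of_slope (ub : UniformBounds Φ L K ς) (hl : IsLarge L K) {m : ℕ}
    (hne : retFn Φ L (orb Φ L a x m) ≠ 0) (hd : Real.log L / 1000 ≤ depth Φ L a x m)
    (hs : Real.exp (depth Φ L a x m + Real.log K) ≤ |slope Φ L (orb Φ L a x m)|) :
    Recovery Φ L K a x m 0 := by
  have hκ := ub.log_nonneg
  unfold IsLarge at hl
  have hder : der Φ L a (orb Φ L a x m) (1 + 0) = slope Φ L (orb Φ L a x m) := by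
    rw [add_zero, show (1 : ℕ) = 0 + 1 from rfl, der_succ, der_zero, mul_one, orb_zero]
  refine ⟨fun k hk => ?_, ?_, ?_, fun j hj => ?_⟩
  · obtain rfl : k = 0 := by omega
    simpa using hne
  · rw [hder]
    exact (Real.exp_le_exp.2 (by linarith)).trans hs
  · rw [hder, add_zero, distSum_succ]
    have h1 : (1 : ℝ) ≤ Real.exp (1 / 10 * depth Φ L a x m) - 1 := by
      have : Real.exp 1 ≤ Real.exp (1 / 10 * depth Φ L a x m) := Real.exp_le_exp.2 (by linarith)
      linarith [two_le_exp_one]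
    have h2 : K * Real.exp (depth Φ L a x m) = Real.exp (depth Φ L a x m + Real.log K) := by
      rw [Real.exp_add, ub.exp_log_K, mul_comm]
    rw [h2]
    gcongr
    exact hs.trans (le_mul_of_one_le_right (abs_nonneg _) h1)
  · obtain rfl : j = 0 := by omega
    rw [add_zero, totalDepth_succ, deepDepth_of_le hd]
    linarith

/-- Choice of the length `p` of the binding period: the first time at which the neighbourhood of
radius `K L e ^ (-2r)` of the critical value is no longer mapped with bounded distortion. -/
lemma UniformBounds.exists_binding (ub : UniformBounds Φ L K ς) (hl : IsLarge L K) {m : ℕ} {r : ℝ}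
    (hr : 4 / 10 * Real.log L ≤ r) (hrm : 8 * r ≤ Real.log L * m)
    (hR : ∀ j ≤ m, totalDepth Φ L a x j ≤ 3 / 10 ^ 5 * (Real.log L * j)) :
    ∃ p : ℕ, p + 1 ≤ m ∧ Real.log L * (p + 1) ≤ 8 * r ∧
      K * L * Real.exp (-(2 * r)) * distSum Φ L K a x p ≤ 1 / 32 ∧
      1 / 32 < K * L * Real.exp (-(2 * r)) * distSum Φ L K a x (p + 1) := by
  have hκ := ub.log_nonneg
  have hK := ub.one_le
  have hl0 : 0 < Real.log L := by unfold IsLarge at hl; linarith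
  have hL1 : 1 ≤ L := by
    by_contra! h
    exact absurd (Real.log_nonpos ub.L_pos.le h.le) (by linarith)
  set k₀ := ⌈2 * r / (9 / 10 * Real.log L)⌉₊ with hk₀
  have hk1 : 2 * r ≤ 9 / 10 * Real.log L * k₀ := by
    have := Nat.le_ceil (2 * r / (9 / 10 * Real.log L))
    rw [div_le_iff₀ (by positivity)] at this
    linarith
  have hk2 : Real.log L * (k₀ + 1) ≤ 8 * r := by
    have h1 := Nat.ceil_lt_add_one (a := 2 * r / (9 / 10 * Real.log L)) (by
      have : 0 ≤ r := by linarith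
      positivity)
    have h2 : (k₀ : ℝ) - 1 < 2 * r / (9 / 10 * Real.log L) := by linarith
    rw [lt_div_iff₀ (by positivity)] at h2
    linarith
  have hk3 : k₀ + 1 ≤ m := by
    have h1 : Real.log L * ((k₀ + 1 : ℕ) : ℝ) ≤ Real.log L * m := by push_cast; linarith
    exact_mod_cast le_of_mul_le_mul_left h1 hl0
  have hk4 : 1 / 32 < K * L * Real.exp (-(2 * r)) * distSum Φ L K a x (k₀ + 1) := by
    have h1 := ub.der_growth hl (a := a) (x := x) (n := k₀) fun j hj => hR j (by omega)
    have h2 : Real.exp (2 * r) ≤ distSum Φ L K a x (k₀ + 1) := by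
      rw [distSum_succ]
      have h3 := ub.distSum_nonneg a x k₀
      have h4 := ub.one_le_weight hl (a := a) (x := x) k₀
      have h5 : |der Φ L a x k₀| ≤ |der Φ L a x k₀| * (K * Real.exp (depth Φ L a x k₀)) :=
        le_mul_of_one_le_right (abs_nonneg _) h4
      have h6 := Real.exp_le_exp.2 hk1
      linarith
    calc (1 : ℝ) / 32 < 1 * 1 * (Real.exp (-(2 * r)) * Real.exp (2 * r)) := by
          rw [← Real.exp_add]; norm_num
      _ ≤ K * L * (Real.exp (-(2 * r)) * distSum Φ L K a x (k₀ + 1)) := by gcongr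
      _ = _ := by ring
  classical
  have hex : ∃ p : ℕ, 1 / 32 < K * L * Real.exp (-(2 * r)) * distSum Φ L K a x (p + 1) :=
    ⟨k₀, hk4⟩
  have hle : Nat.find hex ≤ k₀ := Nat.find_min' hex hk4
  refine ⟨Nat.find hex, by omega, ?_, ?_, Nat.find_spec hex⟩
  · have : (Nat.find hex : ℝ) ≤ k₀ := by exact_mod_cast hle
    have : Real.log L * (Nat.find hex + 1) ≤ Real.log L * (k₀ + 1) := by gcongr
    linarith
  · rcases Nat.eq_zero_or_eq_succ_pred (Nat.find hex) with h | h
    · rw [h]; simp [distSum]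
    · rw [h]
      exact not_lt.1 (Nat.find_min hex (m := (Nat.find hex).pred) (by omega))

/-- At the end of the binding period the derivative along the critical orbit has essentially the
size of the inverse of the distance at which the critical value is shadowed. -/
lemma UniformBounds.distSum_binding_le (ub : UniformBounds Φ L K ς) (hl : IsLarge L K) {p : ℕ}
    {r : ℝ} (hr : 4 / 10 * Real.log L ≤ r) (hp : Real.log L * (p + 1) ≤ 8 * r)
    (hR : ∀ j ≤ p + 1, totalDepth Φ L a x j ≤ 3 / 10 ^ 5 * (Real.log L * j)) :
    distSum Φ L K a x (p + 1) ≤ |der Φ L a x p| * Real.exp (1 / 100 * r) := by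
  have hκ := ub.log_nonneg
  have hl' := hl
  unfold IsLarge at hl'
  have hl0 : 0 < Real.log L := by linarith
  have hK := ub.one_le
  have hRp := hR (p + 1) le_rfl
  have hV : ∀ k < p + 1, |retFn Φ L (orb Φ L a x k)| = Real.exp (-depth Φ L a x k) :=
    fun k hk => abs_ret_eq_of_totalDepth hl0 (hR (k + 1) hk)
  push_cast at hRp
  set R := totalDepth Φ L a x (p + 1) with hRdef
  have hterm : ∀ k ∈ Finset.range (p + 1),
      |der Φ L a x k| * (K * Real.exp (depth Φ L a x k)) ≤
        |der Φ L a x p| * Real.exp (Real.log K + Real.log L / 1000 + 2 * R) := by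
    intro k hk
    have hkp : k ≤ p := by simpa [Nat.lt_succ_iff] using hk
    have h1 := ub.growth hl hkp fun j hj => hV j (by omega)
    have h2 : Real.exp (-R) ≤ Real.exp (99 / 100 * Real.log L * ((p : ℝ) - k) -
        (totalDepth Φ L a x p - totalDepth Φ L a x k)) := by
      refine Real.exp_le_exp.2 ?_
      have h3 : (k : ℝ) ≤ p := by exact_mod_cast hkp
      have h4 : 0 ≤ Real.log L * ((p : ℝ) - k) := mul_nonneg hl0.le (by linarith)
      have h5 := totalDepth_mono (Φ := Φ) hl0.le a x (Nat.le_succ p)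
      have h6 := totalDepth_nonneg (Φ := Φ) hl0.le a x k
      simp only [Nat.succ_eq_add_one] at h5
      linarith
    have h3 : depth Φ L a x k ≤ R + Real.log L / 1000 := by
      have h4 := depth_le_deepDepth_add (Φ := Φ) hl0.le a x k
      have h5 := deepDepth_le_totalDepth (Φ := Φ) hl0.le a x k
      have h6 := totalDepth_mono (Φ := Φ) hl0.le a x (show k + 1 ≤ p + 1 by omega)
      linarith
    have h4 : |der Φ L a x k| ≤ |der Φ L a x p| * Real.exp R := by
      calc |der Φ L a x k| = |der Φ L a x k| * Real.exp (-R) * Real.exp R := by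
            rw [mul_assoc, ← Real.exp_add]; simp
        _ ≤ |der Φ L a x p| * Real.exp R := by
            gcongr
            exact le_trans (by gcongr) h1
    calc _ ≤ (|der Φ L a x p| * Real.exp R) * (Real.exp (Real.log K) *
          Real.exp (R + Real.log L / 1000)) := by
          rw [ub.exp_log_K]
          gcongr
      _ = _ := by
          rw [mul_assoc, ← Real.exp_add, ← Real.exp_add]; congr 2; ring
  have hsum : distSum Φ L K a x (p + 1) ≤ ((p : ℝ) + 1) * (|der Φ L a x p| *
      Real.exp (Real.log K + Real.log L / 1000 + 2 * R)) := by
    refine (Finset.sum_le_sum hterm).trans ?_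
    rw [Finset.sum_const, Finset.card_range, nsmul_eq_mul]
    push_cast; exact le_rfl
  have hp1 : (p : ℝ) + 1 ≤ Real.exp (p + 1) := by
    linarith [Real.add_one_le_exp ((p : ℝ) + 1)]
  have hp2 : 10 ^ 6 * ((p : ℝ) + 1) ≤ 8 * r := by
    refine le_trans ?_ hp
    gcongr
    linarith
  calc distSum Φ L K a x (p + 1) ≤ _ := hsum
    _ ≤ Real.exp (p + 1) * (|der Φ L a x p| *
      Real.exp (Real.log K + Real.log L / 1000 + 2 * R)) := by gcongr
    _ = |der Φ L a x p| * Real.exp ((p + 1) +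
      (Real.log K + Real.log L / 1000 + 2 * R)) := by rw [Real.exp_add ((p : ℝ) + 1)]; ring
    _ ≤ _ := by
      gcongr
      linarith

lemma deepDepth_le_of_depth_le {k : ℕ} {d : ℝ} (h : depth Φ L a x k ≤ d) (hd : 0 ≤ d) :
    deepDepth Φ L a x k ≤ d := by
  unfold deepDepth; split_ifs <;> assumption

set_option maxHeartbeats 1000000 in
/-- A deep return close to a critical point recovers after the binding period, during which the
orbit shadows the critical orbit. -/
lemma UniformBounds.recovery_of_critical (ub : UniformBounds Φ L K ς) (hl : IsLarge L K) {m : ℕ}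
    {z : ℝ} (hV : |retFn Φ L (orb Φ L a x m)| = Real.exp (-depth Φ L a x m))
    (hr : 4 / 10 * Real.log L ≤ depth Φ L a x m) (hrm : 8 * depth Φ L a x m ≤ Real.log L * m)
    (hz : |logMap Φ L 0 (orb Φ L a x m) - logMap Φ L 0 z| ≤
      K * L * |retFn Φ L (orb Φ L a x m)| ^ 2)
    (hR : ∀ j ≤ m, totalDepth Φ L a (logMap Φ L a z) j ≤ 3 / 10 ^ 5 * (Real.log L * j)) :
    ∃ p, Recovery Φ L K a x m p := by
  have hκ := ub.log_nonneg
  have hl' := hl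
  unfold IsLarge at hl'
  have hl0 : 0 < Real.log L := by linarith
  have hK := ub.one_le
  have hL := ub.L_pos
  set r := depth Φ L a x m with hrdef
  set y := logMap Φ L a z with hy
  set X := orb Φ L a x (m + 1) with hX
  obtain ⟨p, hpm, hpr, hp1, hp2⟩ := ub.exists_binding hl hr hrm hR
  set D := K * L * Real.exp (-(2 * r)) with hD
  have hD0 : 0 < D := by positivity
  have hXy : |X - y| ≤ D := by
    have : X - y = logMap Φ L 0 (orb Φ L a x m) - logMap Φ L 0 z := by
      rw [hX, hy, orb_succ, logMap_eq Φ L a, logMap_eq Φ L a]; ring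
    rw [this, hD]
    refine hz.trans (le_of_eq ?_)
    rw [hV, ← Real.exp_nat_mul]; congr 2; push_cast; ring
  have hVy : ∀ k ≤ p, |retFn Φ L (orb Φ L a y k)| = Real.exp (-depth Φ L a y k) :=
    fun k hk => abs_ret_eq_of_totalDepth hl0 (hR (k + 1) (by omega))
  have hVy0 : ∀ k < p, retFn Φ L (orb Φ L a y k) ≠ 0 := fun k hk h0 => by
    have := hVy k hk.le
    rw [h0, abs_zero] at this
    exact (Real.exp_pos _).ne this
  have hdist : ∑ k ∈ Finset.range p, |der Φ L a y k| * (K / |retFn Φ L (orb Φ L a y k)|) =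
      distSum Φ L K a y p := by
    refine Finset.sum_congr rfl fun k hk => ?_
    rw [hVy k (Finset.mem_range.1 hk).le, Real.exp_neg, div_inv_eq_mul]
  have shadow := fun k hk => ub.shadowing (a := a) (x := y) (κ := 0) le_rfl hD0.le (n := p) hVy0
    (by rw [hdist]; exact hp1) (by norm_num) (k := k) hk
  have hXs : y + (X - y) = X := by ring
  have hdiff : ∀ k ≤ p, |orb Φ L a X k - orb Φ L a y k| ≤ 2 * |der Φ L a y k| * D := by
    intro k hk
    have h1 := (shadow k hk).1 (X - y) 0 hXy (by simpa using hD0.le)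
    simp only [zero_mul, add_zero, hXs, sub_zero] at h1
    have h2 : |orb Φ L a X k - orb Φ L a y k| ≤
        |orb Φ L a X k - orb Φ L a y k - der Φ L a y k * (X - y)| + |der Φ L a y k * (X - y)| := by
      simpa using abs_add_le (orb Φ L a X k - orb Φ L a y k - der Φ L a y k * (X - y))
        (der Φ L a y k * (X - y))
    rw [abs_mul] at h2
    have h3 : |der Φ L a y k| * |X - y| ≤ |der Φ L a y k| * D := by gcongr
    have h4 : 0 ≤ |der Φ L a y k| * D := by positivity
    linarith
  have hderX : ∀ k ≤ p, |der Φ L a X k - der Φ L a y k| ≤ 1 / 2 * |der Φ L a y k| := by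
    intro k hk
    have h1 := (shadow k hk).2 (X - y) hXy
    simpa only [zero_mul, add_zero, hXs] using h1
  have hderX_le : ∀ k ≤ p, |der Φ L a X k| ≤ 2 * |der Φ L a y k| := by
    intro k hk
    have := abs_sub_abs_le_abs_sub (der Φ L a X k) (der Φ L a y k)
    linarith [hderX k hk, abs_nonneg (der Φ L a y k)]
  have hderX_ge : |der Φ L a y p| / 2 ≤ |der Φ L a X p| := by
    have := abs_sub_abs_le_abs_sub (der Φ L a y p) (der Φ L a X p)
    rw [abs_sub_comm] at this
    linarith [hderX p le_rfl]
  have hVX : ∀ k < p, |retFn Φ L (orb Φ L a y k)| / 2 ≤ |retFn Φ L (orb Φ L a X k)| := by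
    intro k hk
    refine (ub.distort _ _ (hVy0 k hk) ((hdiff k hk.le).trans ?_)).2.1
    have h1 : D * (|der Φ L a y k| * (K / |retFn Φ L (orb Φ L a y k)|)) ≤ 1 / 32 := by
      refine le_trans (mul_le_mul_of_nonneg_left ?_ hD0.le) hp1
      rw [← hdist]
      exact Finset.single_le_sum
        (f := fun k => |der Φ L a y k| * (K / |retFn Φ L (orb Φ L a y k)|))
        (fun j _ => by positivity) (Finset.mem_range.2 hk)
    have h0 : 0 < |retFn Φ L (orb Φ L a y k)| := abs_pos.2 (hVy0 k hk)
    have h2 : D * (|der Φ L a y k| * (K / |retFn Φ L (orb Φ L a y k)|)) =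
        |der Φ L a y k| * D / (|retFn Φ L (orb Φ L a y k)| / K) := by field_simp
    rw [h2, div_le_iff₀ (by positivity)] at h1
    have : 0 < |retFn Φ L (orb Φ L a y k)| / K := by positivity
    linarith
  have horb : ∀ k, orb Φ L a x (m + 1 + k) = orb Φ L a X k := fun k => orb_add _ _ _ _ _ _
  have hdepthX : ∀ k < p, depth Φ L a x (m + 1 + k) ≤ depth Φ L a y k + Real.log 2 := by
    intro k hk
    have h1 : Real.exp (-(depth Φ L a y k + Real.log 2)) ≤
        Real.exp (-depth Φ L a x (m + 1 + k)) := by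
      refine le_trans ?_ (abs_ret_le Φ L a x (m + 1 + k))
      rw [horb, neg_add, Real.exp_add, ← hVy k hk.le, Real.exp_neg (Real.log 2),
        Real.exp_log two_pos, ← div_eq_mul_inv]
      exact hVX k hk
    have := Real.exp_le_exp.1 h1
    linarith
  set σ := |slope Φ L (orb Φ L a x m)| with hσ
  have hσ1 : Real.exp (Real.log L - r - 2 * Real.log K) ≤ σ := ub.le_slope hV
  have hG : |der Φ L a (orb Φ L a x m) (1 + p)| = σ * |der Φ L a X p| := by
    rw [der_add, abs_mul, ← orb_add, ← hX, show der Φ L a (orb Φ L a x m) 1 =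
      slope Φ L (orb Φ L a x m) by
        rw [show (1 : ℕ) = 0 + 1 from rfl, der_succ, der_zero, mul_one, orb_zero]]
  set T := |der Φ L a y p| with hT
  set G := |der Φ L a (orb Φ L a x m) (1 + p)| with hGdef
  have hGT : σ * T / 2 ≤ G := by
    rw [hG]
    have : σ * (T / 2) ≤ σ * |der Φ L a X p| := by gcongr
    linarith
  have hbind : distSum Φ L K a y (p + 1) ≤ T * Real.exp (1 / 100 * r) :=
    ub.distSum_binding_le hl hr hpr fun j hj => hR j (by omega)
  have hDexp : D = Real.exp (Real.log K + Real.log L - 2 * r) := by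
    rw [hD, sub_eq_add_neg, Real.exp_add, Real.exp_add, ub.exp_log_K, Real.exp_log hL]
  have h32 : (32 : ℝ) ≤ Real.exp 5 := by
    have : Real.exp 5 = Real.exp 1 ^ 5 := by rw [← Real.exp_nat_mul]; norm_num
    rw [this]
    calc (32 : ℝ) = 2 ^ 5 := by norm_num
      _ ≤ _ := by gcongr; exact two_le_exp_one
  -- the derivative along the binding period is nearly the inverse of the shadowing distance
  have hTge : Real.exp (199 / 100 * r - Real.log K - Real.log L - 5) ≤ T := by
    have h1 : 1 / 32 < D * (T * Real.exp (1 / 100 * r)) :=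
      hp2.trans_le (mul_le_mul_of_nonneg_left hbind hD0.le)
    have h2 : Real.exp (-5) ≤ 1 / 32 := by
      rw [Real.exp_neg, one_div]
      exact inv_anti₀ (by norm_num) h32
    have h3 : D * (T * Real.exp (1 / 100 * r)) =
        T * Real.exp (Real.log K + Real.log L - 199 / 100 * r) := by
      rw [hDexp, mul_left_comm, ← Real.exp_add]; congr 2; ring
    rw [h3] at h1
    have h4 : Real.exp (199 / 100 * r - Real.log K - Real.log L - 5) =
        Real.exp (-5) / Real.exp (Real.log K + Real.log L - 199 / 100 * r) := by
      rw [← Real.exp_sub]; congr 1; ring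
    rw [h4, div_le_iff₀ (Real.exp_pos _)]
    linarith
  have hGge : Real.exp (99 / 100 * r - 3 * Real.log K - 6) ≤ G := by
    refine le_trans ?_ hGT
    have h1 : Real.exp (Real.log L - r - 2 * Real.log K) *
        Real.exp (199 / 100 * r - Real.log K - Real.log L - 5) ≤ σ * T := by gcongr
    rw [← Real.exp_add] at h1
    have h2 : 2 * Real.exp (99 / 100 * r - 3 * Real.log K - 6) ≤
        Real.exp 1 * Real.exp (99 / 100 * r - 3 * Real.log K - 6) := by
      gcongr; exact two_le_exp_one
    rw [← Real.exp_add] at h2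
    have h3 : 1 + (99 / 100 * r - 3 * Real.log K - 6) = Real.log L - r - 2 * Real.log K +
        (199 / 100 * r - Real.log K - Real.log L - 5) := by ring
    rw [h3] at h2
    linarith
  refine ⟨p, fun k hk => ?_, ?_, ?_, ?_⟩
  · rcases Nat.eq_zero_or_eq_succ_pred k with h | h
    · rw [h, add_zero]
      intro h0
      rw [h0, abs_zero] at hV
      exact (Real.exp_pos _).ne hV
    · rw [h, Nat.succ_eq_add_one, add_comm _ 1, ← add_assoc, horb]
      have h1 := hVX k.pred (by omega)
      have h2 : 0 < |retFn Φ L (orb Φ L a y k.pred)| := abs_pos.2 (hVy0 _ (by omega))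
      exact abs_pos.1 (by linarith)
  · exact (Real.exp_le_exp.2 (by linarith)).trans hGge
  · have hsplit : distSum Φ L K a x (m + 1 + p) = distSum Φ L K a x m +
        |der Φ L a x m| * (K * Real.exp r) + ∑ k ∈ Finset.range p,
          |der Φ L a x (m + 1 + k)| * (K * Real.exp (depth Φ L a x (m + 1 + k))) := by
      rw [hrdef, ← distSum_succ]
      exact Finset.sum_range_add _ _ _
    have hs1 : ∑ k ∈ Finset.range p,
          |der Φ L a x (m + 1 + k)| * (K * Real.exp (depth Φ L a x (m + 1 + k))) ≤
        |der Φ L a x m| * (4 * σ * distSum Φ L K a y p) := by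
      unfold distSum
      rw [Finset.mul_sum, Finset.mul_sum]
      refine Finset.sum_le_sum fun k hk => ?_
      have hk := Finset.mem_range.1 hk
      have h1 : |der Φ L a x (m + 1 + k)| = |der Φ L a x m| * (σ * |der Φ L a X k|) := by
        rw [der_add, der_succ, abs_mul, abs_mul]; ring
      have h2 : Real.exp (depth Φ L a x (m + 1 + k)) ≤ 2 * Real.exp (depth Φ L a y k) := by
        have := Real.exp_le_exp.2 (hdepthX k hk)
        rwa [Real.exp_add, Real.exp_log two_pos, mul_comm] at this
      calc _ ≤ |der Φ L a x m| * (σ * (2 * |der Φ L a y k|)) *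
            (K * (2 * Real.exp (depth Φ L a y k))) := by
            rw [h1]; gcongr; exact hderX_le k hk.le
        _ = _ := by ring
    have hs2 : 4 * σ * distSum Φ L K a y p ≤ 8 * Real.exp (1 / 100 * r) * G := by
      have h1 : distSum Φ L K a y p ≤ T * Real.exp (1 / 100 * r) := by
        refine le_trans ?_ hbind
        rw [distSum_succ]
        have : 0 ≤ |der Φ L a y p| * (K * Real.exp (depth Φ L a y p)) := by positivity
        linarith
      calc 4 * σ * distSum Φ L K a y p ≤ 4 * σ * (T * Real.exp (1 / 100 * r)) := by gcongr
        _ = 8 * Real.exp (1 / 100 * r) * (σ * T / 2) := by ring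
        _ ≤ _ := by gcongr
    have hs3 : K * Real.exp r ≤ Real.exp (1 / 100 * r + 4 * Real.log K + 6) * G := by
      calc K * Real.exp r = Real.exp (1 / 100 * r + 4 * Real.log K + 6) *
            Real.exp (99 / 100 * r - 3 * Real.log K - 6) := by
            rw [← Real.exp_add, ← ub.exp_log_K, ← Real.exp_add, Real.log_exp]; congr 1; ring
        _ ≤ _ := by gcongr
    have hs4 : 8 * Real.exp (1 / 100 * r) + Real.exp (1 / 100 * r + 4 * Real.log K + 6) ≤
        Real.exp (1 / 10 * r) - 1 := by
      set A := Real.exp (1 / 100 * r + 4 * Real.log K + 6) with hA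
      have h1 : Real.exp (1 / 100 * r) ≤ A := Real.exp_le_exp.2 (by linarith)
      have h2 : 1 ≤ A := Real.one_le_exp (by linarith)
      have h3 : Real.exp 5 * A ≤ Real.exp (1 / 10 * r) := by
        rw [hA, ← Real.exp_add]; exact Real.exp_le_exp.2 (by linarith)
      nlinarith
    rw [hsplit]
    have h5 : K * Real.exp r + 4 * σ * distSum Φ L K a y p ≤ G * (Real.exp (1 / 10 * r) - 1) := by
      have : G * (8 * Real.exp (1 / 100 * r) + Real.exp (1 / 100 * r + 4 * Real.log K + 6)) ≤
        G * (Real.exp (1 / 10 * r) - 1) := by gcongr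
      linarith
    have h6 := mul_le_mul_of_nonneg_left h5 (abs_nonneg (der Φ L a x m))
    linarith
  · intro j hj
    have h1 : totalDepth Φ L a x (m + 1 + j) = totalDepth Φ L a x m + r +
        ∑ k ∈ Finset.range j, deepDepth Φ L a x (m + 1 + k) := by
      rw [hrdef, ← deepDepth_of_le (show Real.log L / 1000 ≤ depth Φ L a x m by linarith),
        ← totalDepth_succ]
      exact Finset.sum_range_add _ _ _
    have h2 : ∑ k ∈ Finset.range j, deepDepth Φ L a x (m + 1 + k) ≤
        totalDepth Φ L a y j + j * (Real.log L / 1000 + 1) := by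
      unfold totalDepth
      have : (j : ℝ) * (Real.log L / 1000 + 1) =
          ∑ k ∈ Finset.range j, (Real.log L / 1000 + 1) := by simp; ring
      rw [this, ← Finset.sum_add_distrib]
      refine Finset.sum_le_sum fun k hk => ?_
      have h3 := hdepthX k (lt_of_lt_of_le (Finset.mem_range.1 hk) hj)
      have h4 := depth_le_deepDepth_add (Φ := Φ) hl0.le a y k
      have h5 := deepDepth_nonneg (Φ := Φ) hl0.le a y k
      have h6 : Real.log 2 ≤ 1 := by linarith [Real.log_two_lt_d9]
      exact deepDepth_le_of_depth_le (by linarith) (by linarith)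
    have h3 := hR j (by omega)
    have h4 : (j : ℝ) ≤ p := by exact_mod_cast hj
    have h5 : Real.log L * j ≤ 8 * r := by
      have : Real.log L * j ≤ Real.log L * (p + 1) := by gcongr; linarith
      linarith
    have h6 : (j : ℝ) * 10 ^ 6 ≤ Real.log L * j := by
      rw [mul_comm]
      gcongr
      linarith
    rw [h1]
    linarith

lemma UniformBounds.exists_recovery (ub : UniformBounds Φ L K ς) (hl : IsLarge L K) {m : ℕ}
    (hV : |retFn Φ L (orb Φ L a x m)| = Real.exp (-depth Φ L a x m))
    (hd : Real.log L / 1000 ≤ depth Φ L a x m) (hrm : 8 * depth Φ L a x m ≤ Real.log L * m)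
    (hR : ∀ c, Φ c ≠ 0 → retFn Φ L c = 0 → ∀ j ≤ m,
      totalDepth Φ L a (logMap Φ L a c) j ≤ 3 / 10 ^ 5 * (Real.log L * j)) :
    ∃ p, Recovery Φ L K a x m p := by
  have hκ := ub.log_nonneg
  have hl' := hl
  unfold IsLarge at hl'
  have hK := ub.one_le
  have hL := ub.L_pos
  set r := depth Φ L a x m with hrdef
  have hne : retFn Φ L (orb Φ L a x m) ≠ 0 := fun h0 => by
    rw [h0, abs_zero] at hV
    exact (Real.exp_pos _).ne hV
  by_cases hr : r ≤ 4 / 10 * Real.log L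
  · refine ⟨0, ub.recovery_of_slope hl hne hd ?_⟩
    exact (Real.exp_le_exp.2 (by linarith)).trans (ub.le_slope hV)
  push Not at hr
  have hK' : Real.exp (-Real.log K) = 1 / K := by rw [Real.exp_neg, ub.exp_log_K, one_div]
  rcases ub.near (orb Φ L a x m) (by
    rw [hV, ← hK']; exact Real.exp_le_exp.2 (by linarith)) with h | ⟨z, hz, hΦz, hzd⟩
  · refine ⟨0, ub.recovery_of_slope hl hne hd ?_⟩
    set V := |retFn Φ L (orb Φ L a x m)| with hVdef
    have hV0 : 0 < V := abs_pos.2 hne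
    have hΦ : 0 < |Φ (orb Φ L a x m)| := abs_pos.2 fun h0 => hne (by unfold retFn; simp [h0])
    have h1 : Real.exp (Real.log L - 2 * Real.log K + r) = L * V / (K * V) ^ 2 := by
      have : Real.exp r = V⁻¹ := by rw [hV, Real.exp_neg, inv_inv]
      rw [Real.exp_add, this, two_mul, Real.exp_sub, Real.exp_add, ub.exp_log_K,
        Real.exp_log hL]
      field_simp
    calc Real.exp (r + Real.log K) ≤ Real.exp (Real.log L - 2 * Real.log K + r) :=
          Real.exp_le_exp.2 (by linarith)
      _ = L * V / (K * V) ^ 2 := h1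
      _ ≤ L * V / |Φ (orb Φ L a x m)| ^ 2 := by gcongr
      _ = _ := by unfold slope; rw [abs_div, abs_mul, abs_of_pos hL, abs_pow]
  · exact ub.recovery_of_critical hl hV hr.le hrm hzd (hR z hΦz hz)

/-! ### The total depth is controlled by the essential returns -/

/-- The state of an orbit at a free time `m`, that is at a time not belonging to a binding period:
the accumulated distortion exceeds the derivative by a factor `2 e ^ h` at most, and the deficit `h`
together with the total depth is paid for by the essential returns. -/
def FreeState (Φ : ℝ → ℝ) (L K a x : ℝ) (m : ℕ) : Prop :=
  (∀ k < m, retFn Φ L (orb Φ L a x k) ≠ 0) ∧ ∃ h, 0 ≤ h ∧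
    distSum Φ L K a x m + |der Φ L a x m| ≤ 2 * Real.exp h * |der Φ L a x m| ∧
    totalDepth Φ L a x m + 12 * h ≤ 3 * totalEss Φ L K a x m

lemma freeState_zero (Φ : ℝ → ℝ) (L K a x : ℝ) : FreeState Φ L K a x 0 :=
  ⟨fun k hk => absurd hk (Nat.not_lt_zero k), 0, le_rfl, by simp [distSum, der_zero],
    by simp [totalDepth, totalEss]⟩

/-- Outside the deep returns the expansion is so strong that the state does not deteriorate. -/
lemma UniformBounds.freeState_succ (ub : UniformBounds Φ L K ς) (hl : IsLarge L K) {m : ℕ}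
    (h : FreeState Φ L K a x m) (hd : depth Φ L a x m < Real.log L / 1000) :
    FreeState Φ L K a x (m + 1) := by
  have hκ := ub.log_nonneg
  have hK := ub.one_le
  have hl' := hl
  unfold IsLarge at hl'
  have hl0 : 0 < Real.log L := by linarith
  obtain ⟨hne, h, h0, h1, h2⟩ := h
  have hV : |retFn Φ L (orb Φ L a x m)| = Real.exp (-depth Φ L a x m) := by
    refine abs_ret_eq (hd.trans_le ?_)
    have : (0 : ℝ) ≤ Real.log L * m := by positivity
    linarith
  refine ⟨fun k hk => ?_, h, h0, ?_, ?_⟩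
  · rcases (Nat.lt_succ_iff.1 hk).eq_or_lt with rfl | hk
    · intro h0
      rw [h0, abs_zero] at hV
      exact (Real.exp_pos _).ne hV
    · exact hne k hk
  · have hσ := ub.le_slope hV
    rw [distSum_succ, der_succ, abs_mul]
    set σ := |slope Φ L (orb Φ L a x m)|
    set T := |der Φ L a x m|
    have hT : 0 ≤ T := abs_nonneg _
    have hσ1 : 2 * (K * Real.exp (depth Φ L a x m)) ≤ σ := by
      calc _ ≤ Real.exp 1 * (Real.exp (Real.log K) * Real.exp (depth Φ L a x m)) := by
            rw [ub.exp_log_K]; gcongr; exact two_le_exp_one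
        _ ≤ Real.exp (Real.log L - depth Φ L a x m - 2 * Real.log K) := by
            rw [← Real.exp_add, ← Real.exp_add]; exact Real.exp_le_exp.2 (by linarith)
        _ ≤ σ := hσ
    have hσ4 : 4 ≤ σ := by
      calc (4 : ℝ) = 2 * 2 := by norm_num
        _ ≤ Real.exp 1 * Real.exp 1 := by gcongr <;> exact two_le_exp_one
        _ ≤ Real.exp (Real.log L - depth Φ L a x m - 2 * Real.log K) := by
            rw [← Real.exp_add]; exact Real.exp_le_exp.2 (by linarith)
        _ ≤ σ := hσ
    have he : 1 ≤ Real.exp h := Real.one_le_exp h0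
    have b1 : 4 * (Real.exp h * T) ≤ σ * (Real.exp h * T) := by gcongr
    have b2 : T * (2 * (K * Real.exp (depth Φ L a x m))) ≤ T * σ := by gcongr
    have b3 : 1 * (σ * T) ≤ Real.exp h * (σ * T) := by gcongr
    linarith
  · have : deepDepth Φ L a x m = 0 := by unfold deepDepth; rw [if_neg (by linarith)]
    rw [totalDepth_succ, totalEss_succ, this]
    linarith [essDepth_nonneg (Φ := Φ) (K := K) hl0.le a x m]

/-- A deep return that is not essential is paid for by the deficit. -/
lemma depth_le_of_not_ess {m : ℕ} {h : ℝ} (hl : IsLarge L K) (hκ : 0 ≤ Real.log K)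
    (hd : Real.log L / 1000 ≤ depth Φ L a x m)
    (h1 : distSum Φ L K a x m + |der Φ L a x m| ≤ 2 * Real.exp h * |der Φ L a x m|)
    (hess : ¬ distSum Φ L K a x m + |der Φ L a x m| ≤
      Real.exp (depth Φ L a x m / 4) * |der Φ L a x m|) :
    depth Φ L a x m ≤ 5 * h := by
  unfold IsLarge at hl
  push Not at hess
  have h3 : Real.exp (depth Φ L a x m / 4) < 2 * Real.exp h :=
    lt_of_mul_lt_mul_right (hess.trans_le h1) (abs_nonneg _)
  have h4 : 2 * Real.exp h ≤ Real.exp (1 + h) := by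
    rw [Real.exp_add]; gcongr; exact two_le_exp_one
  have := Real.exp_lt_exp.1 (h3.trans_le h4)
  linarith

lemma essDepth_of_ess {m : ℕ} (hd : Real.log L / 1000 ≤ depth Φ L a x m)
    (hess : distSum Φ L K a x m + |der Φ L a x m| ≤
      Real.exp (depth Φ L a x m / 4) * |der Φ L a x m|) :
    essDepth Φ L K a x m = depth Φ L a x m := by
  unfold essDepth; rw [if_pos ⟨hd, hess⟩]

/-- Within a recovery period the total depth stays below three times the essential one. -/
lemma UniformBounds.totalDepth_le_of_recovery (ub : UniformBounds Φ L K ς) (hl : IsLarge L K)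
    {m p j : ℕ} (h : FreeState Φ L K a x m) (hd : Real.log L / 1000 ≤ depth Φ L a x m)
    (hrec : Recovery Φ L K a x m p) (hj : j ≤ p) :
    totalDepth Φ L a x (m + 1 + j) ≤ 3 * totalEss Φ L K a x (m + 1 + j) := by
  have hκ := ub.log_nonneg
  have hl0 : 0 < Real.log L := by unfold IsLarge at hl; linarith
  obtain ⟨-, h, h0, h1, h2⟩ := h
  have h3 := hrec.depth_le j hj
  have h4 := totalEss_mono (Φ := Φ) (K := K) hl0.le a x (show m + 1 ≤ m + 1 + j by omega)
  rw [totalEss_succ] at h4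
  by_cases hess : distSum Φ L K a x m + |der Φ L a x m| ≤
      Real.exp (depth Φ L a x m / 4) * |der Φ L a x m|
  · rw [essDepth_of_ess hd hess] at h4
    linarith
  · have := depth_le_of_not_ess hl hκ hd h1 hess
    linarith [essDepth_nonneg (Φ := Φ) (K := K) hl0.le a x m]

/-- The state after recovery: an essential return pays for itself, and another one is paid for by a
decrease of the deficit. -/
lemma UniformBounds.freeState_of_recovery (ub : UniformBounds Φ L K ς) (hl : IsLarge L K)
    {m p : ℕ} (h : FreeState Φ L K a x m) (hd : Real.log L / 1000 ≤ depth Φ L a x m)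
    (hrec : Recovery Φ L K a x m p) : FreeState Φ L K a x (m + 1 + p) := by
  have hκ := ub.log_nonneg
  have hl' := hl
  unfold IsLarge at hl'
  have hl0 : 0 < Real.log L := by linarith
  obtain ⟨hne, h, h0, h1, h2⟩ := h
  have h3 := hrec.depth_le p le_rfl
  have h4 := totalEss_mono (Φ := Φ) (K := K) hl0.le a x (show m + 1 ≤ m + 1 + p by omega)
  rw [totalEss_succ] at h4
  have hD := hrec.dist_le
  have hG := hrec.der_ge
  have hder : |der Φ L a x (m + 1 + p)| =
      |der Φ L a x m| * |der Φ L a (orb Φ L a x m) (1 + p)| := by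
    rw [add_assoc, der_add, abs_mul]
  set r := depth Φ L a x m with hr
  set T := |der Φ L a x m| with hT
  set G := |der Φ L a (orb Φ L a x m) (1 + p)|
  have hT0 : 0 ≤ T := abs_nonneg _
  refine ⟨fun k hk => ?_, ?_⟩
  · rcases lt_or_ge k m with hkm | hkm
    · exact hne k hkm
    · have := hrec.ret_ne (k - m) (by omega)
      rwa [Nat.add_sub_cancel' hkm] at this
  rw [hder]
  by_cases hess : distSum Φ L K a x m + T ≤ Real.exp (r / 4) * T
  · rw [essDepth_of_ess hd hess] at h4
    refine ⟨1 / 10 * r, by linarith, ?_, by linarith⟩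
    have b1 : Real.exp (r / 4) * T ≤ G * T := by
      gcongr
      exact (Real.exp_le_exp.2 (by linarith)).trans hG
    have b2 : 1 * (T * G) ≤ Real.exp (1 / 10 * r) * (T * G) := by
      gcongr
      exact Real.one_le_exp (by linarith)
    linarith
  · have hrh := depth_le_of_not_ess hl hκ hd h1 hess
    refine ⟨h - 1 / 10 * r, by linarith, ?_, by
      linarith [essDepth_nonneg (Φ := Φ) (K := K) hl0.le a x m]⟩
    have b1 : 2 * Real.exp h * T ≤ Real.exp (h - 1 / 10 * r) * (T * G) := by
      calc 2 * Real.exp h * T ≤ Real.exp 1 * Real.exp h * T := by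
            gcongr; exact two_le_exp_one
        _ ≤ Real.exp (h - 1 / 10 * r) * Real.exp (9 / 10 * r) * T := by
            rw [← Real.exp_add, ← Real.exp_add]
            exact mul_le_mul_of_nonneg_right (Real.exp_le_exp.2 (by linarith)) hT0
        _ ≤ Real.exp (h - 1 / 10 * r) * G * T := by gcongr
        _ = _ := by ring
    have b2 : Real.exp (1 / 10 * r) * (T * G) ≤ Real.exp (h - 1 / 10 * r) * (T * G) := by
      gcongr
      linarith
    linarith

/-- If the total depth of the essential returns is a very small proportion of the time for all
critical orbits, then the total depth of all deep returns is a small proportion of the time. The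
numerical constants only have to satisfy `10⁻⁵ ≪ 10⁻³ ≪ 1`, where `10⁻³` is the threshold for deep
returns. -/
theorem UniformBounds.totalDepth_le (ub : UniformBounds Φ L K ς) (hl : IsLarge L K) (N : ℕ)
    (hE : ∀ c, Φ c ≠ 0 → retFn Φ L c = 0 → ∀ m ≤ N,
      totalEss Φ L K a (logMap Φ L a c) m ≤ 1 / 10 ^ 5 * (Real.log L * m)) :
    ∀ c, Φ c ≠ 0 → retFn Φ L c = 0 → ∀ m ≤ N,
      totalDepth Φ L a (logMap Φ L a c) m ≤ 3 / 10 ^ 5 * (Real.log L * m) := by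
  have hκ := ub.log_nonneg
  have hl0 : 0 < Real.log L := by unfold IsLarge at hl; linarith
  induction N with
  | zero =>
    intro c _ _ m hm
    obtain rfl : m = 0 := by omega
    simp [totalDepth]
  | succ N ih =>
    have hG := ih fun c h1 h2 m hm => hE c h1 h2 m (by omega)
    intro c hc hc' n hn
    rcases hn.lt_or_eq with hn | hn
    · exact hG c hc hc' n (by omega)
    subst hn
    set x := logMap Φ L a c with hx
    have hEx : ∀ m ≤ N + 1, totalEss Φ L K a x m ≤ 1 / 10 ^ 5 * (Real.log L * m) := hE c hc hc'
    -- downward induction on the free time `m = N + 1 - d`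
    have key : ∀ d m, m + d = N + 1 → FreeState Φ L K a x m →
        totalDepth Φ L a x (N + 1) ≤ 3 * totalEss Φ L K a x (N + 1) := by
      intro d
      induction d using Nat.strong_induction_on with
      | _ d ihd =>
      intro m hm hfree
      rcases Nat.eq_zero_or_pos d with rfl | hd0
      · obtain ⟨-, h, h0, h1, h2⟩ := hfree
        obtain rfl : m = N + 1 := by omega
        linarith
      by_cases hd : Real.log L / 1000 ≤ depth Φ L a x m
      swap
      · exact ihd (d - 1) (by omega) (m + 1) (by omega)
          (ub.freeState_succ hl hfree (not_le.1 hd))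
      have hr : depth Φ L a x m ≤ 2 / 10 ^ 5 * (Real.log L * (m + 1)) := by
        obtain ⟨-, h, h0, h1, h2⟩ := hfree
        by_cases hess : distSum Φ L K a x m + |der Φ L a x m| ≤
            Real.exp (depth Φ L a x m / 4) * |der Φ L a x m|
        · have h3 := hEx (m + 1) (by omega)
          rw [totalEss_succ, essDepth_of_ess hd hess] at h3
          push_cast at h3
          have := totalEss_nonneg (Φ := Φ) (K := K) hl0.le a x m
          have : 0 ≤ Real.log L * (m + 1) := by positivity
          linarith
        · have h3 := depth_le_of_not_ess hl hκ hd h1 hess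
          have h4 := hEx m (by omega)
          have := totalDepth_nonneg (Φ := Φ) hl0.le a x m
          have : 0 ≤ Real.log L * m := by positivity
          linarith
      -- a deep return is impossible at time zero, so that the binding period fits into `[0, m]`
      have hm1 : (1 : ℝ) ≤ m := by
        have : m ≠ 0 := by
          rintro rfl
          push_cast at hr
          linarith
        exact_mod_cast Nat.one_le_iff_ne_zero.2 this
      have hlm : Real.log L * 1 ≤ Real.log L * m := by gcongr
      obtain ⟨p, hrec⟩ := ub.exists_recovery hl (abs_ret_eq (by linarith)) hd (by linarith)
        fun c h1 h2 j hj => hG c h1 h2 j (by omega)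
      rcases le_or_gt (m + 1 + p) (N + 1) with hp | hp
      · exact ihd (N + 1 - (m + 1 + p)) (by omega) _ (by omega)
          (ub.freeState_of_recovery hl hfree hd hrec)
      · have := ub.totalDepth_le_of_recovery hl hfree hd hrec (j := N - m) (by omega)
        rwa [show m + 1 + (N - m) = N + 1 by omega] at this
    have h1 := key (N + 1) 0 (by omega) (freeState_zero Φ L K a x)
    have h2 := hEx (N + 1) le_rfl
    linarith

/-! ### Parameter exclusion -/

/-- A consequence of Vitali's covering lemma: if, for each `b`, the smaller balls with centres in
`ball b (5 * ρ b)` are contained in `ball b (θ * ρ b)`, then the union of the smaller balls has at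
most `θ` times the measure of the union of the larger ones. -/
lemma volume_iUnion_ball_le {A : Set ℝ} {ρ ρ' : ℝ → ℝ} {θ B : ℝ} (hθ : 0 ≤ θ)
    (hρ : ∀ a ∈ A, 0 < ρ a) (hB : ∀ a ∈ A, ρ a ≤ B)
    (h : ∀ b ∈ A, ∀ a ∈ A, |a - b| < 5 * ρ b → |a - b| + ρ' a ≤ θ * ρ b) :
    volume (⋃ a ∈ A, Metric.ball a (ρ' a)) ≤
      ENNReal.ofReal θ * volume (⋃ a ∈ A, Metric.ball a (ρ a)) := by
  obtain ⟨u, huA, hdisj, hcov⟩ := Vitali.exists_disjoint_subfamily_covering_enlargement_ball A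
    (fun a => a) ρ B hB 5 (by norm_num)
  have hu : u.Countable := hdisj.countable_of_isOpen (fun _ _ => Metric.isOpen_ball)
    fun a ha => Metric.nonempty_ball.2 (hρ a (huA ha))
  have hsub : (⋃ a ∈ A, Metric.ball a (ρ' a)) ⊆ ⋃ b ∈ u, Metric.ball b (θ * ρ b) := by
    refine Set.iUnion₂_subset fun a ha => ?_
    obtain ⟨b, hb, hab⟩ := hcov a ha
    have h1 := hab (Metric.mem_ball_self (hρ a ha))
    rw [Metric.mem_ball, Real.dist_eq] at h1
    refine Set.subset_iUnion₂_of_subset b hb (Metric.ball_subset_ball' ?_)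
    rw [Real.dist_eq, add_comm]
    exact h b (huA hb) a ha h1
  calc volume (⋃ a ∈ A, Metric.ball a (ρ' a)) ≤ volume (⋃ b ∈ u, Metric.ball b (θ * ρ b)) :=
        measure_mono hsub
    _ ≤ ∑' b : u, volume (Metric.ball (b : ℝ) (θ * ρ b)) := measure_biUnion_le volume hu _
    _ = ∑' b : u, ENNReal.ofReal θ * volume (Metric.ball (b : ℝ) (ρ b)) := by
        refine tsum_congr fun b => ?_
        rw [Real.volume_ball, Real.volume_ball, ← ENNReal.ofReal_mul hθ]
        congr 1; ring
    _ = ENNReal.ofReal θ * volume (⋃ b ∈ u, Metric.ball b (ρ b)) := by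
        rw [ENNReal.tsum_mul_left,
          measure_biUnion hu hdisj fun _ _ => Metric.isOpen_ball.measurableSet]
    _ ≤ _ := by
        exact mul_le_mul_right (measure_mono (Set.biUnion_subset_biUnion_left huA)) _

/-- The derivatives grow so fast that the derivative with respect to the parameter is comparable to
the one in phase space. -/
lemma UniformBounds.sum_inv_der_le (ub : UniformBounds Φ L K ς) (hl : IsLarge L K) {m : ℕ}
    (hR : ∀ j ≤ m, totalDepth Φ L a x j ≤ 3 / 10 ^ 5 * (Real.log L * j)) :
    ∑ k ∈ Finset.range m, 1 / |der Φ L a x (k + 1)| ≤ 1 / 8 := by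
  have hκ := ub.log_nonneg
  unfold IsLarge at hl
  have hgeom : ∀ n : ℕ, ∑ k ∈ Finset.range n, (1 / 16 : ℝ) ^ (k + 1) ≤
      1 / 8 * (1 - (1 / 16) ^ n) := by
    intro n
    induction n with
    | zero => simp
    | succ n ih =>
      rw [Finset.sum_range_succ]
      have : (0 : ℝ) ≤ (1 / 16) ^ n := by positivity
      rw [pow_succ]
      linarith
  have h16 : (16 : ℝ) ≤ Real.exp (9 / 10 * Real.log L) := by
    calc (16 : ℝ) = 2 ^ 4 := by norm_num
      _ ≤ Real.exp 1 ^ 4 := by gcongr; exact two_le_exp_one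
      _ = Real.exp 4 := by rw [← Real.exp_nat_mul]; norm_num
      _ ≤ _ := Real.exp_le_exp.2 (by linarith)
  calc _ ≤ ∑ k ∈ Finset.range m, (1 / 16 : ℝ) ^ (k + 1) := by
        refine Finset.sum_le_sum fun k hk => ?_
        have hk := Finset.mem_range.1 hk
        have h1 := ub.der_growth (n := k + 1) hl fun j hj => hR j (by omega)
        have h2 : (16 : ℝ) ^ (k + 1) ≤ |der Φ L a x (k + 1)| := by
          refine le_trans ?_ h1
          rw [mul_comm _ ((k + 1 : ℕ) : ℝ), Real.exp_nat_mul]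
          gcongr
        rw [one_div_pow]
        exact one_div_le_one_div_of_le (by positivity) h2
    _ ≤ 1 / 8 * (1 - (1 / 16) ^ m) := hgeom m
    _ ≤ 1 / 8 := by
      have : (0 : ℝ) ≤ (1 / 16) ^ m := by positivity
      linarith

/-- The radius of a neighbourhood of the parameter `a` on which the position at time `m` of the
orbit of the critical value `f_a c` varies with bounded distortion. -/
noncomputable def radius (Φ : ℝ → ℝ) (L K s c : ℝ) (m : ℕ) (a : ℝ) : ℝ :=
  s / (distSum Φ L K a (logMap Φ L a c) m + |der Φ L a (logMap Φ L a c) m|)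

variable {s c : ℝ}

lemma UniformBounds.distSum_add_der_le (ub : UniformBounds Φ L K ς) (hl : IsLarge L K) (a x : ℝ)
    (m : ℕ) : distSum Φ L K a x m + |der Φ L a x m| ≤ distSum Φ L K a x (m + 1) := by
  rw [distSum_succ]
  have := le_mul_of_one_le_right (abs_nonneg (der Φ L a x m))
    (ub.one_le_weight hl (a := a) (x := x) m)
  linarith

lemma UniformBounds.one_le_distSum_add_der (ub : UniformBounds Φ L K ς) (hl : IsLarge L K)
    (a x : ℝ) (m : ℕ) : 1 ≤ distSum Φ L K a x m + |der Φ L a x m| := by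
  induction m with
  | zero => simp [distSum, der_zero]
  | succ m ih =>
    linarith [ub.distSum_add_der_le hl a x m, abs_nonneg (der Φ L a x (m + 1))]

lemma UniformBounds.radius_pos (ub : UniformBounds Φ L K ς) (hl : IsLarge L K) (hs : 0 < s)
    (c : ℝ) (m : ℕ) (a : ℝ) : 0 < radius Φ L K s c m a :=
  div_pos hs (by linarith [ub.one_le_distSum_add_der hl a (logMap Φ L a c) m])

lemma UniformBounds.radius_le (ub : UniformBounds Φ L K ς) (hl : IsLarge L K) (hs : 0 < s)
    (c : ℝ) (m : ℕ) (a : ℝ) : radius Φ L K s c m a ≤ s :=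
  div_le_self hs.le (ub.one_le_distSum_add_der hl a (logMap Φ L a c) m)

lemma UniformBounds.radius_succ_le (ub : UniformBounds Φ L K ς) (hl : IsLarge L K) (hs : 0 < s)
    (c : ℝ) (m : ℕ) (a : ℝ) : radius Φ L K s c (m + 1) a ≤ radius Φ L K s c m a := by
  have h1 := ub.one_le_distSum_add_der hl a (logMap Φ L a c) m
  have h2 := ub.distSum_add_der_le hl a (logMap Φ L a c) m
  unfold radius
  exact div_le_div_of_nonneg_left hs.le (by linarith)
    (by linarith [abs_nonneg (der Φ L a (logMap Φ L a c) (m + 1))])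

/-- Two parameters whose critical orbits are close to each other up to time `m`, and both of which
have an essential return of depth at least `- log t` at that time, are much closer to each other than the
radius of bounded distortion. -/
lemma UniformBounds.parameter_cluster (ub : UniformBounds Φ L K ς) (hl : IsLarge L K) (hs : 0 < s)
    (hs1 : 160 * s ≤ 1) (hs2 : 8 * s ≤ ς) {m : ℕ} {t q a b : ℝ} (ht : 0 < t)
    (hR : ∀ j ≤ m, totalDepth Φ L b (logMap Φ L b c) j ≤ 3 / 10 ^ 5 * (Real.log L * j))
    (hta : Real.exp (-depth Φ L a (logMap Φ L a c) m) ≤ t)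
    (htb : Real.exp (-depth Φ L b (logMap Φ L b c) m) ≤ t)
    (hq : distSum Φ L K b (logMap Φ L b c) m + |der Φ L b (logMap Φ L b c) m| ≤
      q * |der Φ L b (logMap Φ L b c) m|)
    (hab : |a - b| < 5 * radius Φ L K s c m b) :
    |a - b| + radius Φ L K s c (m + 1) a ≤ 4 * K / s * (q * t) * radius Φ L K s c m b := by
  have hκ := ub.log_nonneg
  have hl0 : 0 < Real.log L := by unfold IsLarge at hl; linarith
  have hK := ub.one_le
  set x := logMap Φ L b c with hx
  have hxa : logMap Φ L a c = x + (a - b) := by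
    rw [hx, logMap_eq Φ L a, logMap_eq Φ L b]; ring
  have haa : b + 1 * (a - b) = a := by ring
  have hrad : radius Φ L K s c m b = s / (distSum Φ L K b x m + |der Φ L b x m|) := rfl
  have h1 := ub.one_le_distSum_add_der hl b x m
  have hV : ∀ k < m, |retFn Φ L (orb Φ L b x k)| = Real.exp (-depth Φ L b x k) :=
    fun k hk => abs_ret_eq_of_totalDepth hl0 (hR (k + 1) hk)
  have hV0 : ∀ k < m, retFn Φ L (orb Φ L b x k) ≠ 0 := fun k hk h0 => by
    have := hV k hk
    rw [h0, abs_zero] at this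
    exact (Real.exp_pos _).ne this
  set T := |der Φ L b x m| with hT
  have hT0 : 0 < T := abs_pos.2 (der_ne_zero ub.L_pos hV0)
  have hDs := ub.distSum_nonneg b x m
  set D := 5 * radius Φ L K s c m b with hD
  have hD0 : 0 < D := by have := ub.radius_pos hl hs c m b; positivity
  have hdist : ∑ k ∈ Finset.range m, |der Φ L b x k| * (K / |retFn Φ L (orb Φ L b x k)|) =
      distSum Φ L K b x m := by
    refine Finset.sum_congr rfl fun k hk => ?_
    rw [hV k (Finset.mem_range.1 hk), Real.exp_neg, div_inv_eq_mul]
  have hDle : D * (distSum Φ L K b x m + T) = 5 * s := by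
    rw [hD, hrad]; field_simp
  have hDT : D * T ≤ 5 * s := by rw [← hDle]; gcongr; linarith
  have shadow := ub.shadowing (a := b) (x := x) (κ := 1) zero_le_one hD0.le (n := m) hV0
    (by
      rw [hdist]
      have : D * distSum Φ L K b x m ≤ D * (distSum Φ L K b x m + T) := by gcongr; linarith
      linarith)
    (by rw [one_mul]; exact ub.sum_inv_der_le hl hR) le_rfl
  have sh1 := shadow.1 (a - b) 0 hab.le (by simpa using hD0.le)
  have sh2 := shadow.2 (a - b) hab.le
  rw [haa, ← hxa] at sh1 sh2
  simp only [mul_zero, add_zero, sub_zero] at sh1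
  set P := orb Φ L a (logMap Φ L a c) m with hP
  set Q := orb Φ L b x m with hQ
  have hTab : |der Φ L b x m * (a - b)| = T * |a - b| := abs_mul _ _
  have up : |P - Q| ≤ 3 / 2 * (T * |a - b|) := by
    have := abs_sub_abs_le_abs_sub (P - Q) (der Φ L b x m * (a - b))
    linarith
  have low : T * |a - b| ≤ 2 * |P - Q| := by
    have := abs_sub_abs_le_abs_sub (der Φ L b x m * (a - b)) (P - Q)
    rw [abs_sub_comm (der Φ L b x m * (a - b))] at this
    linarith
  have hPQς : |P - Q| ≤ ς := by
    have : T * |a - b| ≤ D * T := by rw [mul_comm]; gcongr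
    linarith
  have hPQ : |P - Q| ≤ K * t := ub.sep t P Q ((abs_ret_le Φ L a _ m).trans hta)
    ((abs_ret_le Φ L b x m).trans htb) hPQς
  have hTa : T / 2 ≤ |der Φ L a (logMap Φ L a c) m| := by
    have := abs_sub_abs_le_abs_sub (der Φ L b x m) (der Φ L a (logMap Φ L a c) m)
    rw [abs_sub_comm] at this
    linarith
  have hab' : |a - b| ≤ 2 * K * t / T := by
    rw [le_div_iff₀ hT0]; linarith
  have hrad' : radius Φ L K s c (m + 1) a ≤ 2 * s * t / T := by
    have h2 : T / 2 * (1 * (1 / t)) ≤ distSum Φ L K a (logMap Φ L a c) (m + 1) := by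
      rw [distSum_succ]
      have h3 : 1 / t ≤ Real.exp (depth Φ L a (logMap Φ L a c) m) := by
        rw [one_div, ← neg_neg (depth Φ L a (logMap Φ L a c) m), Real.exp_neg]
        exact inv_anti₀ (Real.exp_pos _) hta
      have h4 := ub.distSum_nonneg a (logMap Φ L a c) m
      have h5 : T / 2 * (1 * (1 / t)) ≤ |der Φ L a (logMap Φ L a c) m| *
          (K * Real.exp (depth Φ L a (logMap Φ L a c) m)) := by gcongr
      linarith
    unfold radius
    rw [div_le_iff₀ (by
      linarith [ub.one_le_distSum_add_der hl a (logMap Φ L a c) (m + 1)])]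
    calc s = 2 * s * t / T * (T / 2 * (1 * (1 / t))) := by field_simp
      _ ≤ _ := by
        gcongr
        linarith [abs_nonneg (der Φ L a (logMap Φ L a c) (m + 1))]
  have hsK : s ≤ K := by linarith
  calc |a - b| + radius Φ L K s c (m + 1) a ≤ 2 * K * t / T + 2 * s * t / T :=
        add_le_add hab' hrad'
    _ ≤ 2 * K * t / T + 2 * K * t / T := by gcongr
    _ = 4 * K / s * t * (s / T) := by field_simp; ring
    _ ≤ 4 * K / s * t * (q * (s / (distSum Φ L K b x m + T))) := by
      gcongr
      rw [← mul_div_assoc, div_le_div_iff₀ hT0 (by linarith)]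
      calc s * (distSum Φ L K b x m + T) ≤ s * (q * T) := by gcongr
        _ = q * s * T := by ring
    _ = _ := by rw [hrad]; ring

/-- The union of the neighbourhoods of bounded distortion at time `m` of the parameters in `A`. -/
def nbhd (Φ : ℝ → ℝ) (L K s c : ℝ) (A : Set ℝ) (m : ℕ) : Set ℝ :=
  ⋃ a ∈ A, Metric.ball a (radius Φ L K s c m a)

lemma UniformBounds.nbhd_succ_subset (ub : UniformBounds Φ L K ς) (hl : IsLarge L K) (hs : 0 < s)
    (c : ℝ) (A : Set ℝ) (m : ℕ) : nbhd Φ L K s c A (m + 1) ⊆ nbhd Φ L K s c A m :=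
  Set.iUnion₂_mono fun a _ => Metric.ball_subset_ball (ub.radius_succ_le hl hs c m a)

lemma UniformBounds.volume_nbhd_succ_le (ub : UniformBounds Φ L K ς) (hl : IsLarge L K)
    (hs : 0 < s) (hs1 : 160 * s ≤ 1) (hs2 : 8 * s ≤ ς) {A : Set ℝ} {m : ℕ} {t q : ℝ} (ht : 0 < t)
    (hq0 : 0 ≤ q)
    (hR : ∀ a ∈ A, ∀ j ≤ m,
      totalDepth Φ L a (logMap Φ L a c) j ≤ 3 / 10 ^ 5 * (Real.log L * j))
    (ht' : ∀ a ∈ A, Real.exp (-depth Φ L a (logMap Φ L a c) m) ≤ t)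
    (hq : ∀ a ∈ A, distSum Φ L K a (logMap Φ L a c) m + |der Φ L a (logMap Φ L a c) m| ≤
      q * |der Φ L a (logMap Φ L a c) m|) :
    volume (nbhd Φ L K s c A (m + 1)) ≤
      ENNReal.ofReal (4 * K / s * (q * t)) * volume (nbhd Φ L K s c A m) := by
  have hK := ub.one_le
  exact volume_iUnion_ball_le (by positivity) (fun a _ => ub.radius_pos hl hs c m a)
    (fun a _ => ub.radius_le hl hs c m a) fun b hb a ha hab =>
      ub.parameter_cluster hl hs hs1 hs2 ht (hR b hb) (ht' a ha) (ht' b hb) (hq b hb) hab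

lemma UniformBounds.volume_nbhd_zero_le (ub : UniformBounds Φ L K ς) (hl : IsLarge L K)
    (hs : 0 < s) (hs1 : 160 * s ≤ 1) {A : Set ℝ} (hA : A ⊆ Set.Ico 0 1) :
    volume (nbhd Φ L K s c A 0) ≤ ENNReal.ofReal 3 := by
  have hsub : nbhd Φ L K s c A 0 ⊆ Set.Ioo (-1) 2 := by
    refine Set.iUnion₂_subset fun a ha y hy => ?_
    have h1 := ub.radius_le hl hs c 0 a
    have h2 := hA ha
    rw [Metric.mem_ball, Real.dist_eq, abs_lt] at hy
    exact ⟨by linarith [h2.1], by linarith [h2.2]⟩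
  refine (measure_mono hsub).trans (le_of_eq ?_)
  rw [Real.volume_Ioo]; norm_num

/-! ### Counting itineraries -/

/-- The depth of the essential return at time `k`, in units of `log L / 1000`; it vanishes if there
is no such return. -/
noncomputable def itinerary (Φ : ℝ → ℝ) (L K c a : ℝ) (k : ℕ) : ℕ :=
  ⌊essDepth Φ L K a (logMap Φ L a c) k / (Real.log L / 1000)⌋₊

/-- The parameters for which the essential returns of the critical orbit of `c` become too deep at
time `N`, whereas no critical orbit has shown too deep essential returns before. -/
def badSet (Φ : ℝ → ℝ) (L K c : ℝ) (N : ℕ) : Set ℝ :=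
  {a | a ∈ Set.Ico (0 : ℝ) 1 ∧
    (∀ c', Φ c' ≠ 0 → retFn Φ L c' = 0 → ∀ m < N,
      totalEss Φ L K a (logMap Φ L a c') m ≤ 1 / 10 ^ 5 * (Real.log L * m)) ∧
    1 / 10 ^ 5 * (Real.log L * N) < totalEss Φ L K a (logMap Φ L a c) N}

lemma UniformBounds.totalDepth_le_of_mem_badSet (ub : UniformBounds Φ L K ς) (hl : IsLarge L K)
    (hc : Φ c ≠ 0) (hc' : retFn Φ L c = 0) {N m : ℕ} (ha : a ∈ badSet Φ L K c N) (hm : m < N) :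
    totalDepth Φ L a (logMap Φ L a c) m ≤ 3 / 10 ^ 5 * (Real.log L * m) :=
  ub.totalDepth_le hl m (fun c' h1 h2 j hj => ha.2.1 c' h1 h2 j (by omega)) c hc hc' m le_rfl

lemma essDepth_pos_of_itinerary (hl0 : 0 < Real.log L) {k : ℕ}
    (h : itinerary Φ L K c a k ≠ 0) :
    (itinerary Φ L K c a k : ℝ) * (Real.log L / 1000) ≤ depth Φ L a (logMap Φ L a c) k ∧
    depth Φ L a (logMap Φ L a c) k ≤ (itinerary Φ L K c a k + 1) * (Real.log L / 1000) ∧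
    distSum Φ L K a (logMap Φ L a c) k + |der Φ L a (logMap Φ L a c) k| ≤
      Real.exp (depth Φ L a (logMap Φ L a c) k / 4) * |der Φ L a (logMap Φ L a c) k| := by
  have hb : 0 < Real.log L / 1000 := by positivity
  have h1 := Nat.floor_le (div_nonneg (essDepth_nonneg (Φ := Φ) (K := K) hl0.le a
    (logMap Φ L a c) k) hb.le)
  have h2 := Nat.lt_floor_add_one (essDepth Φ L K a (logMap Φ L a c) k / (Real.log L / 1000))
  change (itinerary Φ L K c a k : ℝ) ≤ _ at h1
  change _ < (itinerary Φ L K c a k : ℝ) + 1 at h2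
  rw [le_div_iff₀ hb] at h1
  rw [div_lt_iff₀ hb] at h2
  have h3 : 0 < essDepth Φ L K a (logMap Φ L a c) k := by
    have : (0 : ℝ) < itinerary Φ L K c a k := by exact_mod_cast Nat.pos_of_ne_zero h
    exact (mul_pos this hb).trans_le h1
  unfold essDepth at h1 h2 h3
  split_ifs at h1 h2 h3 with h4
  · exact ⟨h1, h2.le, h4.2⟩
  · exact absurd h3 (lt_irrefl _)

lemma essDepth_le_itinerary (hl0 : 0 < Real.log L) (k : ℕ) :
    essDepth Φ L K a (logMap Φ L a c) k ≤
      2 * (itinerary Φ L K c a k : ℝ) * (Real.log L / 1000) := by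
  have hb : 0 < Real.log L / 1000 := by positivity
  have h2 := Nat.lt_floor_add_one (essDepth Φ L K a (logMap Φ L a c) k / (Real.log L / 1000))
  change _ < (itinerary Φ L K c a k : ℝ) + 1 at h2
  rw [div_lt_iff₀ hb] at h2
  rcases Nat.eq_zero_or_pos (itinerary Φ L K c a k) with h | h
  · rw [h] at h2 ⊢
    unfold essDepth at h2 ⊢
    split_ifs at h2 ⊢ with h4
    · have := h4.1
      norm_num at h2
      linarith
    · simp
  · have : (1 : ℝ) ≤ itinerary Φ L K c a k := by exact_mod_cast h
    nlinarith

lemma itinerary_le (hl0 : 0 < Real.log L) (k : ℕ) :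
    itinerary Φ L K c a k ≤ 1000 * (k + 1) := by
  have hb : 0 < Real.log L / 1000 := by positivity
  refine Nat.floor_le_of_le ?_
  rw [div_le_iff₀ hb]
  have h1 := depth_le Φ L a (logMap Φ L a c) k
  push_cast
  unfold essDepth
  split_ifs
  · linarith
  · positivity

/-- The measure of the bad parameters with a given itinerary: each essential return contributes a
factor that is exponentially small in its depth. -/
lemma UniformBounds.volume_itinerary_le (ub : UniformBounds Φ L K ς) (hl : IsLarge L K)
    (hs : 0 < s) (hs1 : 160 * s ≤ 1) (hs2 : 8 * s ≤ ς)
    (hKs : 4 * K / s ≤ Real.exp (Real.log L / 8000)) (hc : Φ c ≠ 0) (hc' : retFn Φ L c = 0)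
    {N : ℕ} {A : Set ℝ} (hA : A ⊆ badSet Φ L K c N) (ρ : ℕ → ℕ)
    (hρ : ∀ a ∈ A, ∀ k < N, itinerary Φ L K c a k = ρ k) :
    volume A ≤ ENNReal.ofReal
      (3 * ∏ k ∈ Finset.range N, Real.exp (-(Real.log L / 8000)) ^ (3 * ρ k)) := by
  have hκ := ub.log_nonneg
  have hK := ub.one_le
  have hl0 : 0 < Real.log L := by unfold IsLarge at hl; linarith
  have key : ∀ m ≤ N, volume (nbhd Φ L K s c A m) ≤ ENNReal.ofReal
      (3 * ∏ k ∈ Finset.range m, Real.exp (-(Real.log L / 8000)) ^ (3 * ρ k)) := by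
    intro m
    induction m with
    | zero =>
      intro _
      simpa using ub.volume_nbhd_zero_le hl hs hs1 fun a ha => (hA ha).1
    | succ m ih =>
      intro hm
      have ih := ih (by omega)
      rw [Finset.prod_range_succ]
      rcases Nat.eq_zero_or_pos (ρ m) with h0 | h0
      · rw [h0]
        simpa using (measure_mono (ub.nbhd_succ_subset hl hs c A m)).trans ih
      have hmain := ub.volume_nbhd_succ_le hl hs hs1 hs2 (c := c) (A := A) (m := m)
        (t := Real.exp (-(ρ m * (Real.log L / 1000))))
        (q := Real.exp ((ρ m + 1) * (Real.log L / 1000) / 4)) (Real.exp_pos _)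
        (Real.exp_pos _).le
        (fun a ha j hj => ub.totalDepth_le_of_mem_badSet hl hc hc' (hA ha) (by omega))
        (fun a ha => by
          have h1 := hρ a ha m (by omega)
          have h2 := essDepth_pos_of_itinerary hl0 (Φ := Φ) (K := K) (c := c) (a := a) (k := m)
            (by omega)
          rw [h1] at h2
          exact Real.exp_le_exp.2 (by linarith [h2.1]))
        (fun a ha => by
          have h1 := hρ a ha m (by omega)
          have h2 := essDepth_pos_of_itinerary hl0 (Φ := Φ) (K := K) (c := c) (a := a) (k := m)
            (by omega)
          rw [h1] at h2
          refine h2.2.2.trans ?_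
          gcongr
          exact h2.2.1)
      have hfac : 4 * K / s * (Real.exp ((ρ m + 1) * (Real.log L / 1000) / 4) *
          Real.exp (-(ρ m * (Real.log L / 1000)))) ≤
          Real.exp (-(Real.log L / 8000)) ^ (3 * ρ m) := by
        have hρ1 : (1 : ℝ) ≤ ρ m := by exact_mod_cast h0
        have hρl : Real.log L * 1 ≤ Real.log L * ρ m := by gcongr
        calc _ ≤ Real.exp (Real.log L / 8000) * (Real.exp ((ρ m + 1) * (Real.log L / 1000) / 4) *
              Real.exp (-(ρ m * (Real.log L / 1000)))) := by gcongr
          _ ≤ _ := by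
            rw [← Real.exp_add, ← Real.exp_add, ← Real.exp_nat_mul]
            refine Real.exp_le_exp.2 ?_
            push_cast
            linarith
      calc _ ≤ _ := hmain
        _ ≤ ENNReal.ofReal (Real.exp (-(Real.log L / 8000)) ^ (3 * ρ m)) * ENNReal.ofReal
            (3 * ∏ k ∈ Finset.range m, Real.exp (-(Real.log L / 8000)) ^ (3 * ρ k)) :=
          mul_le_mul' (ENNReal.ofReal_le_ofReal hfac) ih
        _ = _ := by
          rw [← ENNReal.ofReal_mul (by positivity)]
          congr 1; ring
  refine (measure_mono fun a ha => ?_).trans (key N le_rfl)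
  exact Set.mem_iUnion₂.2 ⟨a, ha, Metric.mem_ball_self (ub.radius_pos hl hs c N a)⟩

/-- The total weight of all sequences of length `N` is at most `2 ^ N`. -/
lemma sum_prod_pow_le {y : ℝ} (hy0 : 0 ≤ y) (hy : y ≤ 1 / 2) (N M : ℕ) :
    ∑ r ∈ Fintype.piFinset fun _ : Fin N => Finset.range M, ∏ k, y ^ r k ≤ 2 ^ N := by
  rw [← Finset.prod_univ_sum (fun _ : Fin N => Finset.range M) fun _ j => y ^ j]
  rw [Finset.prod_const, Finset.card_univ, Fintype.card_fin]
  have h1 : ∑ j ∈ Finset.range M, y ^ j ≤ 2 := by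
    have hy1 : y < 1 := by linarith
    refine ((summable_geometric_of_lt_one hy0 hy1).sum_le_tsum _ fun _ _ => by positivity).trans ?_
    rw [tsum_geometric_of_lt_one hy0 hy1, inv_le_comm₀ (by linarith) (by norm_num)]
    linarith
  gcongr

lemma UniformBounds.volume_badSet_le (ub : UniformBounds Φ L K ς) (hl : IsLarge L K)
    (hs : 0 < s) (hs1 : 160 * s ≤ 1) (hs2 : 8 * s ≤ ς)
    (hKs : 4 * K / s ≤ Real.exp (Real.log L / 8000)) (hc : Φ c ≠ 0) (hc' : retFn Φ L c = 0)
    (N : ℕ) : volume (badSet Φ L K c N) ≤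
      ENNReal.ofReal (3 * (2 * Real.exp (-(Real.log L / 800000))) ^ N) := by
  have hκ := ub.log_nonneg
  have hl' := hl
  unfold IsLarge at hl'
  have hl0 : 0 < Real.log L := by linarith
  set y := Real.exp (-(Real.log L / 8000)) with hy
  have hy0 : 0 < y := Real.exp_pos _
  have hyhalf : y ≤ 1 / 2 := by
    rw [hy, Real.exp_neg, one_div]
    refine inv_anti₀ two_pos (two_le_exp_one.trans (Real.exp_le_exp.2 (by linarith)))
  have hyN : y ^ ((1 : ℝ) / 100 * N) = Real.exp (-(Real.log L / 800000)) ^ N := by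
    rw [hy, ← Real.exp_mul, ← Real.exp_nat_mul]; congr 1; ring
  classical
  set ext : (Fin N → ℕ) → ℕ → ℕ := fun r k => if h : k < N then r ⟨k, h⟩ else 0 with hext
  set F := (Fintype.piFinset fun _ : Fin N => Finset.range (1000 * N + 1)).filter
    fun r => (N : ℝ) / 200 ≤ ∑ k, (r k : ℝ) with hF
  have hcover : badSet Φ L K c N ⊆ ⋃ r ∈ F,
      {a | a ∈ badSet Φ L K c N ∧ ∀ k < N, itinerary Φ L K c a k = ext r k} := by
    intro a ha
    refine Set.mem_iUnion₂.2 ⟨fun k => itinerary Φ L K c a k, ?_, ha, fun k hk => by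
      simp [hext, hk]⟩
    rw [hF, Finset.mem_filter]
    refine ⟨Fintype.mem_piFinset.2 fun k => ?_, ?_⟩
    · have h1 := itinerary_le (Φ := Φ) (K := K) (c := c) (a := a) hl0 k
      have h2 := k.2
      rw [Finset.mem_range]
      omega
    · have h1 := ha.2.2
      have h2 : totalEss Φ L K a (logMap Φ L a c) N ≤
          ∑ k ∈ Finset.range N, 2 * (itinerary Φ L K c a k : ℝ) * (Real.log L / 1000) :=
        Finset.sum_le_sum fun k _ => essDepth_le_itinerary hl0 k
      rw [← Finset.sum_mul, ← Finset.mul_sum, Finset.sum_range] at h2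
      have h3 : Real.log L * ((N : ℝ) / 200) ≤
          Real.log L * ∑ k : Fin N, (itinerary Φ L K c a k : ℝ) := by linarith
      exact le_of_mul_le_mul_left h3 hl0
  have hone : ∀ r ∈ F,
      volume {a | a ∈ badSet Φ L K c N ∧ ∀ k < N, itinerary Φ L K c a k = ext r k} ≤
        ENNReal.ofReal (3 * Real.exp (-(Real.log L / 800000)) ^ N * ∏ k, y ^ r k) := by
    intro r hr
    refine (ub.volume_itinerary_le hl hs hs1 hs2 hKs hc hc' (fun a ha => ha.1) (ext r)
      fun a ha => ha.2).trans (ENNReal.ofReal_le_ofReal ?_)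
    rw [mul_assoc]
    gcongr
    rw [Finset.prod_range, ← hy, ← hyN]
    have h1 : ∀ k : Fin N, ext r k = r k := fun k => by simp [hext]
    simp_rw [h1]
    have hsum := (Finset.mem_filter.1 hr).2
    calc ∏ k, y ^ (3 * r k) = y ^ ((2 : ℝ) * ∑ k, (r k : ℝ)) * ∏ k, y ^ r k := by
          have h2 : ∀ k : Fin N, y ^ (3 * r k) = y ^ (2 * r k) * y ^ r k := fun k => by
            rw [← pow_add]; congr 1; ring
          simp_rw [h2]
          rw [Finset.prod_mul_distrib]
          congr 1
          rw [Finset.prod_pow_eq_pow_sum, ← Real.rpow_natCast]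
          congr 1
          push_cast
          rw [Finset.mul_sum]
      _ ≤ _ := by
          gcongr ?_ * _
          exact Real.rpow_le_rpow_of_exponent_ge hy0 (by linarith) (by linarith)
  calc volume (badSet Φ L K c N) ≤ ∑ r ∈ F,
        volume {a | a ∈ badSet Φ L K c N ∧ ∀ k < N, itinerary Φ L K c a k = ext r k} :=
        (measure_mono hcover).trans (measure_biUnion_finset_le _ _)
    _ ≤ ∑ r ∈ F, ENNReal.ofReal (3 * Real.exp (-(Real.log L / 800000)) ^ N * ∏ k, y ^ r k) :=
        Finset.sum_le_sum hone
    _ = ENNReal.ofReal (∑ r ∈ F, 3 * Real.exp (-(Real.log L / 800000)) ^ N * ∏ k, y ^ r k) :=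
        (ENNReal.ofReal_sum_of_nonneg fun r _ => by positivity).symm
    _ ≤ _ := by
      refine ENNReal.ofReal_le_ofReal ?_
      rw [← Finset.mul_sum]
      calc _ ≤ 3 * Real.exp (-(Real.log L / 800000)) ^ N * 2 ^ N := by
            gcongr
            refine le_trans (Finset.sum_le_sum_of_subset_of_nonneg (Finset.filter_subset _ _)
              fun _ _ _ => by positivity) (sum_prod_pow_le hy0.le hyhalf N (1000 * N + 1))
        _ = _ := by rw [mul_pow]; ring

/-! ### The set of good parameters -/

lemma retFn_add_period {t : ℝ} (ht : ∀ x, Φ (x + t) = Φ x) (L x : ℝ) :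
    retFn Φ L (x + t) = retFn Φ L x := by
  have h : deriv Φ (x + t) = deriv Φ x := by
    have : (fun y => Φ (y + t)) = Φ := funext ht
    rw [← deriv_comp_add_const, this]
  unfold retFn
  rw [ht, h]

lemma logMap_add_period {t : ℝ} (ht : ∀ x, Φ (x + t) = Φ x) (L a x : ℝ) :
    logMap Φ L a (x + t) = logMap Φ L a x + t := by
  unfold logMap; rw [ht]; ring

lemma orb_add_period {t : ℝ} (ht : ∀ x, Φ (x + t) = Φ x) (L a x : ℝ) (k : ℕ) :
    orb Φ L a (x + t) k = orb Φ L a x k + t := by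
  induction k with
  | zero => rfl
  | succ k ih => rw [orb_succ, orb_succ, ih, logMap_add_period ht]

lemma totalEss_add_period {t : ℝ} (ht : ∀ x, Φ (x + t) = Φ x) (L K a x : ℝ) (n : ℕ) :
    totalEss Φ L K a (x + t) n = totalEss Φ L K a x n := by
  have hdep : depth Φ L a (x + t) = depth Φ L a x := by
    funext k; unfold depth; rw [orb_add_period ht, retFn_add_period ht]
  have hder : der Φ L a (x + t) = der Φ L a x := by
    funext k
    unfold der slope
    simp_rw [orb_add_period ht, retFn_add_period ht, ht]
  unfold totalEss essDepth distSum
  rw [hdep, hder]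

/-- The parameters for which the essential returns of some critical orbit are too deep. -/
def exceptionalSet (Φ : ℝ → ℝ) (L K : ℝ) : Set ℝ :=
  {a | a ∈ Set.Ico (0 : ℝ) 1 ∧ ∃ c, Φ c ≠ 0 ∧ retFn Φ L c = 0 ∧
    ∃ n : ℕ, 1 / 10 ^ 5 * (Real.log L * n) < totalEss Φ L K a (logMap Φ L a c) n}

/-- Critical points in a common cell of length `1 / I` coincide, so that modulo `1` there are at
most `I` of them. -/
lemma UniformBounds.subsingleton_cell (ub : UniformBounds Φ L K ς) {I : ℕ} (hI : 1 / ς ≤ I)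
    (i : ℕ) : {c | retFn Φ L c = 0 ∧ (i : ℝ) ≤ I * c ∧ I * c < i + 1}.Subsingleton := by
  rintro y ⟨hy, hy1, hy2⟩ z ⟨hz, hz1, hz2⟩
  have hς := ub.sep_pos
  have hI0 : (0 : ℝ) < I := lt_of_lt_of_le (by positivity) hI
  have h1 : (I : ℝ) * |y - z| ≤ I * ς := by
    rw [div_le_iff₀ hς] at hI
    rw [← abs_of_pos hI0, ← abs_mul, abs_of_pos hI0, mul_sub]
    refine le_trans ?_ hI
    rw [_root_.abs_le]; constructor <;> linarith
  have h2 := ub.sep 0 y z (by simp [hy]) (by simp [hz]) (le_of_mul_le_mul_left h1 hI0)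
  rw [mul_zero, abs_nonpos_iff] at h2
  linarith

lemma UniformBounds.volume_exceptionalSet_le (ub : UniformBounds Φ L K ς) (hl : IsLarge L K)
    (hper : ∀ x, Φ (x + 1) = Φ x) (hs : 0 < s) (hs1 : 160 * s ≤ 1) (hs2 : 8 * s ≤ ς)
    (hKs : 4 * K / s ≤ Real.exp (Real.log L / 8000)) {I : ℕ} (hI : 1 / ς ≤ I)
    (hg : 2 * Real.exp (-(Real.log L / 800000)) ≤ 1 / 2) :
    volume (exceptionalSet Φ L K) ≤
      ENNReal.ofReal (I * (12 * Real.exp (-(Real.log L / 800000)))) := by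
  have hς := ub.sep_pos
  have hI0 : (0 : ℝ) < I := lt_of_lt_of_le (by positivity) hI
  set g := 2 * Real.exp (-(Real.log L / 800000)) with hgdef
  have hg0 : 0 < g := by positivity
  set C : ℕ → Set ℝ := fun i =>
    {c | (retFn Φ L c = 0 ∧ (i : ℝ) ≤ I * c ∧ I * c < i + 1) ∧ Φ c ≠ 0} with hC
  have hsub : exceptionalSet Φ L K ⊆
      ⋃ i ∈ Finset.range I, ⋃ n : ℕ, ⋃ c ∈ C i, badSet Φ L K c (n + 1) := by
    rintro a ⟨ha, c₀, hc₀, hc₀', n₀, hn₀⟩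
    classical
    have hex : ∃ n : ℕ, ∃ c, Φ c ≠ 0 ∧ retFn Φ L c = 0 ∧
        1 / 10 ^ 5 * (Real.log L * n) < totalEss Φ L K a (logMap Φ L a c) n :=
      ⟨n₀, c₀, hc₀, hc₀', hn₀⟩
    obtain ⟨c, hc, hc', hn⟩ := Nat.find_spec hex
    have hmin := fun m (hm : m < Nat.find hex) => Nat.find_min hex hm
    set n := Nat.find hex
    push Not at hmin
    -- translate the critical point into the unit interval
    have hp : ∀ x, Φ (x + (⌊c⌋ : ℝ)) = Φ x := fun x => by
      simpa using (show Function.Periodic Φ 1 from hper).int_mul ⌊c⌋ x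
    have hfr : c = Int.fract c + (⌊c⌋ : ℝ) := (Int.fract_add_floor c).symm
    have hf0 := Int.fract_nonneg c
    have hf1 := Int.fract_lt_one c
    rw [hfr, logMap_add_period hp, totalEss_add_period hp] at hn
    rw [hfr, hp] at hc
    rw [hfr, retFn_add_period hp] at hc'
    have hn0 : n ≠ 0 := by
      intro h0
      rw [h0] at hn
      simp [totalEss] at hn
    have hcell : ⌊(I : ℝ) * Int.fract c⌋₊ < I := by
      rw [Nat.floor_lt (by positivity)]
      nlinarith
    refine Set.mem_iUnion₂.2 ⟨⌊(I : ℝ) * Int.fract c⌋₊, Finset.mem_range.2 hcell,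
      Set.mem_iUnion.2 ⟨n - 1, Set.mem_iUnion₂.2 ⟨Int.fract c, ⟨⟨hc', Nat.floor_le (by positivity),
        Nat.lt_floor_add_one _⟩, hc⟩, ?_⟩⟩⟩
    rw [Nat.sub_add_cancel (Nat.one_le_iff_ne_zero.2 hn0)]
    exact ⟨ha, fun c' h1 h2 m hm => hmin m hm c' h1 h2, hn⟩
  have hcellvol : ∀ i n, volume (⋃ c ∈ C i, badSet Φ L K c (n + 1)) ≤
      ENNReal.ofReal (3 * g * g ^ n) := by
    intro i n
    have hss : (C i).Subsingleton := (ub.subsingleton_cell hI i).anti fun c hc => hc.1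
    rcases hss.eq_empty_or_singleton with h | ⟨c, h⟩
    · rw [h]; simp
    · have hcC : c ∈ C i := by rw [h]; rfl
      rw [h, Set.biUnion_singleton]
      refine (ub.volume_badSet_le hl hs hs1 hs2 hKs hcC.2 hcC.1.1 (n + 1)).trans (le_of_eq ?_)
      congr 1; rw [hgdef, pow_succ]; ring
  have hg1 : g < 1 := by linarith
  have htsum : ∀ i, volume (⋃ n : ℕ, ⋃ c ∈ C i, badSet Φ L K c (n + 1)) ≤
      ENNReal.ofReal (6 * g) := by
    intro i
    calc _ ≤ ∑' n : ℕ, volume (⋃ c ∈ C i, badSet Φ L K c (n + 1)) := measure_iUnion_le _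
      _ ≤ ∑' n : ℕ, ENNReal.ofReal (3 * g * g ^ n) := ENNReal.tsum_le_tsum (hcellvol i)
      _ = ENNReal.ofReal (∑' n : ℕ, 3 * g * g ^ n) :=
        (ENNReal.ofReal_tsum_of_nonneg (fun n => by positivity)
          ((summable_geometric_of_lt_one hg0.le hg1).mul_left _)).symm
      _ ≤ _ := by
        refine ENNReal.ofReal_le_ofReal ?_
        rw [tsum_mul_left, tsum_geometric_of_lt_one hg0.le hg1]
        have : (1 - g)⁻¹ ≤ 2 := by
          rw [inv_le_comm₀ (by linarith) two_pos]; linarith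
        calc 3 * g * (1 - g)⁻¹ ≤ 3 * g * 2 := by gcongr
          _ = 6 * g := by ring
  calc _ ≤ _ := measure_mono hsub
    _ ≤ ∑ i ∈ Finset.range I, volume (⋃ n : ℕ, ⋃ c ∈ C i, badSet Φ L K c (n + 1)) :=
      measure_biUnion_finset_le _ _
    _ ≤ ∑ i ∈ Finset.range I, ENNReal.ofReal (6 * g) := Finset.sum_le_sum fun i _ => htsum i
    _ = ENNReal.ofReal (I * (12 * Real.exp (-(Real.log L / 800000)))) := by
      rw [Finset.sum_const, Finset.card_range, nsmul_eq_mul, ENNReal.ofReal_mul hI0.le,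
        ENNReal.ofReal_natCast, hgdef]
      congr 2; ring

lemma hasDerivAt_iterate (hd : Differentiable ℝ Φ) (hL : L ≠ 0) (a x : ℝ) {n : ℕ}
    (h : ∀ k < n, Φ (orb Φ L a x k) ≠ 0) :
    HasDerivAt ((logMap Φ L a)^[n]) (der Φ L a x n) x := by
  induction n with
  | zero => simpa [der_zero] using hasDerivAt_id x
  | succ n ih =>
    rw [Function.iterate_succ', der_succ]
    exact (hasDerivAt_logMap hd hL a (h n (by omega))).comp x (ih fun k hk => h k (by omega))

/-- Outside the exceptional set the critical orbits avoid the singular set, and the derivatives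
along them grow exponentially. -/
lemma UniformBounds.expansion (ub : UniformBounds Φ L K ς) (hl : IsLarge L K)
    (ha : a ∈ Set.Ico (0 : ℝ) 1) (ha' : a ∉ exceptionalSet Φ L K) (hc : c ∈ criticalSet Φ L a)
    (n : ℕ) : (logMap Φ L a)^[n] (logMap Φ L a c) ∉ singularSet Φ ∧
      L ^ ((1 / 1000 : ℝ) * (n : ℝ)) ≤ |deriv ((logMap Φ L a)^[n]) (logMap Φ L a c)| := by
  have hκ := ub.log_nonneg
  have hl0 : 0 < Real.log L := by unfold IsLarge at hl; linarith
  obtain ⟨hc, hc'⟩ := (mem_criticalSet ub.differentiable ub.L_pos.ne').1 hc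
  have hE : ∀ c, Φ c ≠ 0 → retFn Φ L c = 0 → ∀ m ≤ n + 1,
      totalEss Φ L K a (logMap Φ L a c) m ≤ 1 / 10 ^ 5 * (Real.log L * m) := by
    intro c h1 h2 m _
    by_contra! h
    exact ha' ⟨ha, c, h1, h2, m, h⟩
  have hR := ub.totalDepth_le hl (n + 1) hE c hc hc'
  have hΦ : ∀ k ≤ n, Φ (orb Φ L a (logMap Φ L a c) k) ≠ 0 := by
    intro k hk h0
    have h1 := abs_ret_eq_of_totalDepth hl0 (hR (k + 1) (by omega))
    have h2 : retFn Φ L (orb Φ L a (logMap Φ L a c) k) = 0 := by unfold retFn; simp [h0]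
    rw [h2, abs_zero] at h1
    exact (Real.exp_pos _).ne h1
  refine ⟨hΦ n le_rfl, ?_⟩
  rw [(hasDerivAt_iterate ub.differentiable ub.L_pos.ne' a _ fun k hk => hΦ k hk.le).deriv]
  refine le_trans ?_ (ub.der_growth hl fun j hj => hR j (by omega))
  rw [Real.rpow_def_of_pos ub.L_pos]
  refine Real.exp_le_exp.2 ?_
  have : 0 ≤ Real.log L * n := by positivity
  linarith

end LogMap

theorem mainTheorem1 (Φ : ℝ → ℝ) (hC2 : ContDiff ℝ 2 Φ) (hper : ∀ x, Φ (x + 1) = Φ x)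
    (hzero : ∀ x, Φ x = 0 → deriv Φ x ≠ 0)
    (hcrit : ∀ x, deriv Φ x = 0 → deriv (deriv Φ) x ≠ 0) :
    ∃ (L₀ : ℝ) (Δ : ℝ → Set ℝ), 0 < L₀ ∧
      (∀ L : ℝ, L₀ ≤ L →
        Δ L ⊆ Set.Ico (0 : ℝ) 1 ∧ MeasurableSet (Δ L) ∧ 0 < volume (Δ L) ∧
        ∀ a ∈ Δ L, ∀ c ∈ criticalSet Φ L a, ∀ n : ℕ,
          (logMap Φ L a)^[n] (logMap Φ L a c) ∉ singularSet Φ ∧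
          L ^ ((1 / 1000 : ℝ) * (n : ℝ)) ≤
            |deriv ((logMap Φ L a)^[n]) (logMap Φ L a c)|) ∧
      Tendsto (fun L : ℝ => volume (Δ L)) atTop (𝓝 1) := by
  obtain ⟨K, ς, L₁, hL₁, hub⟩ := LogMap.exists_uniformBounds Φ hC2 hper hzero hcrit
  have hς : 0 < ς := (hub L₁ le_rfl).sep_pos
  obtain ⟨I, hI⟩ := exists_nat_ge (1 / ς)
  set s := min (1 / 160) (ς / 8) with hs
  have hs0 : 0 < s := by positivity
  have hs1 : 160 * s ≤ 1 := by linarith [min_le_left (1 / 160) (ς / 8)]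
  have hs2 : 8 * s ≤ ς := by linarith [min_le_right (1 / 160) (ς / 8)]
  set e : ℝ → ℝ := fun L => I * (12 * Real.exp (-(Real.log L / 800000))) with he
  have hexp : Tendsto (fun L => Real.exp (-(Real.log L / 800000))) atTop (𝓝 0) :=
    Real.tendsto_exp_neg_atTop_nhds_zero.comp
      (Real.tendsto_log_atTop.atTop_div_const (by norm_num))
  have he0 : Tendsto e atTop (𝓝 0) := by
    have := (hexp.const_mul 12).const_mul (I : ℝ)
    simpa [he] using this
  have hev : ∀ᶠ L in atTop, L₁ ≤ L ∧ LogMap.IsLarge L K ∧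
      4 * K / s ≤ Real.exp (Real.log L / 8000) ∧
      2 * Real.exp (-(Real.log L / 800000)) ≤ 1 / 2 ∧ e L < 1 := by
    refine (eventually_ge_atTop L₁).and (Filter.Eventually.and ?_ (Filter.Eventually.and ?_
      (Filter.Eventually.and ?_ ?_)))
    · exact Real.tendsto_log_atTop.eventually_ge_atTop _
    · exact (Real.tendsto_exp_atTop.comp
        (Real.tendsto_log_atTop.atTop_div_const (by norm_num))).eventually_ge_atTop _
    · filter_upwards [hexp.eventually_lt_const (show (0 : ℝ) < 1 / 4 by norm_num)] with L hL
      linarith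
    · exact he0.eventually_lt_const one_pos
  obtain ⟨L₂, hL₂⟩ := eventually_atTop.1 hev
  -- the measurable hull makes a discussion of the measurability of the exceptional set unnecessary
  set Δ : ℝ → Set ℝ := fun L =>
    Set.Ico 0 1 \ toMeasurable volume (LogMap.exceptionalSet Φ L K) with hΔ
  have hvol : ∀ L, L₂ ≤ L → 1 - ENNReal.ofReal (e L) ≤ volume (Δ L) := by
    intro L hL
    obtain ⟨h1, h2, h3, h4, -⟩ := hL₂ L hL
    have h5 := (hub L h1).volume_exceptionalSet_le h2 hper hs0 hs1 hs2 h3 hI h4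
    calc 1 - ENNReal.ofReal (e L) ≤
          volume (Set.Ico (0 : ℝ) 1) -
            volume (toMeasurable volume (LogMap.exceptionalSet Φ L K)) := by
          rw [Real.volume_Ico, measure_toMeasurable, sub_zero, ENNReal.ofReal_one]
          exact tsub_le_tsub_left h5 1
      _ ≤ _ := le_measure_sdiff
  refine ⟨max L₂ 1, Δ, by positivity, fun L hL => ?_, ?_⟩
  · have hL2 : L₂ ≤ L := (le_max_left _ _).trans hL
    obtain ⟨h1, h2, -, -, h5⟩ := hL₂ L hL2
    refine ⟨Set.sdiff_subset, measurableSet_Ico.diff (measurableSet_toMeasurable _ _), ?_,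
      fun a ha c hc n => (hub L h1).expansion h2 ha.1
        (fun h => ha.2 (subset_toMeasurable _ _ h)) hc n⟩
    refine lt_of_lt_of_le ?_ (hvol L hL2)
    rw [tsub_pos_iff_lt, ← ENNReal.ofReal_one]
    exact (ENNReal.ofReal_lt_ofReal_iff one_pos).2 h5
  · have hlim : Tendsto (fun L => 1 - ENNReal.ofReal (e L)) atTop (𝓝 1) := by
      have h1 := ENNReal.tendsto_ofReal he0
      rw [ENNReal.ofReal_zero] at h1
      simpa using ENNReal.Tendsto.sub (tendsto_const_nhds (x := (1 : ENNReal))) h1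
        (Or.inl ENNReal.one_ne_top)
    refine tendsto_of_tendsto_of_tendsto_of_le_of_le' hlim tendsto_const_nhds
      ((eventually_ge_atTop L₂).mono hvol) (Eventually.of_forall fun L => ?_)
    calc volume (Δ L) ≤ volume (Set.Ico (0 : ℝ) 1) := measure_mono Set.sdiff_subset
      _ = 1 := by simp
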